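/- **Setting.** A contextual combinatorial bandit instance with probabilistically triggered arms ($\mathrm{C^2MAB\text{-}T}$) is a tuple $([m],\mathcal S,\Phi,\Theta,D_{\rm trig},R)$: base arms $[m]$; an action space $\mathcal S$; a set $\Phi$ of feature maps $\phi:[m]\to\mathbb R^d$ with $\|\phi(i)\|_2\le 1$; a parameter space $\Theta\subseteq\mathbb R^d$ with $\langle\theta,\phi(i)\rangle\in[0,1]$ for all $\theta\in\Theta,\phi\in\Phi,i\in[m]$; for each action $S$ and outcome vector $x\in\{0,1\}^m$ a law $D_{\rm trig}(S,x)$ on subsets of $[m]$; and a reward $R(S,x,A)\ge 0$. For $\mu\in[0,1]^m$ let $X$ have independent Bernoulli($\mu_i$) entries and $\tau\sim D_{\rm trig}(S,X)$; put $r(S;\mu)=\mathbb E[R(S,X,\tau)]$ and $p_i^{\mu,S}=\Pr[i\in\tau]$. With $\mathcal M=\{(\langle\theta,\phi(i)\rangle)_{i}:\theta\in\Theta,\phi\in\Phi\}$, the batch size is $K=\max_{S\in\mathcal S}|\{i: p_i^{\mu,S}>0\text{ for some }\mu\in\mathcal M\}|$. Write $\mathrm{opt}(\mu)=\sup_{S\in\mathcal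 S} r(S;\mu)$, assumed finite for $\mu\in[0,1]^m$ (it is $r(S^*;\mu)$ when a best action $S^*$ exists). It is assumed that whether exactly the set $A$ is triggered depends on the outcomes only through the revealed ones: $D_{\rm trig}(S,x)(A)=D_{\rm trig}(S,y)(A)$ whenever $x_i=y_i$ for all $i\in A$. *Monotonicity*: $r(S;\mu)\le r(S;\mu')$ for all $S$ and all $\mu\le\mu'$ (entrywise) in $[0,1]^m$. *1-norm TPM smoothness with coefficient $B_1$*: $|r(S;\mu')-r(S;\mu)|\le B_1\sum_{i}p_i^{\mu,S}|\mu_i-\mu_i'|$ for all $S$ and all $\mu,\mu'\in[0,1]^m$. An *$(\alpha,\beta)$-approximation oracle* ($\alpha,\beta\in[0,1]$) maps each $\mu\in[0,1]^m$ to a random action $S$ with $\Pr[r(S;\mu)\ge\alpha\,\mathrm{opt}(\mu)]\ge\beta$. **Protocol.** Let $\theta^*\in\Theta$ with $\|\theta^*\|_2\le 1$. In round $t=1,\dots,T$ a feature map $\phi_t\in\Phi$ is revealed (possibly random and adaptively chosen). Let $\mathcal H_t$ consist of $\phi_t$ and of $\phi_s$, $S_s$, $\tau_s$, $(X_{s,i})_{i\in\tau_s}$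 for $s<t$. The agent plays $S_t$; given $\mathcal H_t$ and $S_t$, the outcomes $X_{t,i}$ are independent Bernoulli with means $\mu_{t,i}=\langle\theta^*,\phi_t(i)\rangle$, and $\tau_t\sim D_{\rm trig}(S_t,X_t)$; the agent observes $\tau_t$ and $(X_{t,i})_{i\in\tau_t}$. **Algorithm $\mathrm{C^2\text{-}UCB\text{-}T}$** (regularizer $\gamma>0$, $\delta=1/T$). With $G_t=\gamma I+\sum_{s<t}\sum_{i\in\tau_s}\phi_s(i)\phi_s(i)^\top$, $b_t=\sum_{s<t}\sum_{i\in\tau_s}X_{s,i}\phi_s(i)$, $\hat\theta_t=G_t^{-1}b_t$ and $\rho=\sqrt{\log\frac{(\gamma+KT/d)^d}{\gamma^d\delta^2}}+\sqrt\gamma$, let $\bar\mu_{t,i}$ be $\langle\phi_t(i),\hat\theta_t\rangle+\rho\,\sqrt{\phi_t(i)^\top G_t^{-1}\phi_t(i)}$ clipped to $[0,1]$. Given $\mathcal H_t$, the action $S_t$ is drawn by the oracle with input $\bar\mu_t$. **Theorem.** There is a universal constant $C>0$ such that the following holds for every such instance that satisfies monotonicity and 1-norm TPM smoothness with coefficient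 $B_1$, every $(\alpha,\beta)$-approximation oracle, and all $\gamma>0$ and $T$ with $K\le\max(\gamma,T)$ and $KT\ge 2\gamma$. The $(\alpha,\beta)$-approximate regret of $\mathrm{C^2\text{-}UCB\text{-}T}$, $\mathrm{Reg}(T)=\mathbb E\big[\sum_{t=1}^T(\alpha\beta\,\mathrm{opt}(\mu_t)-r(S_t;\mu_t))\big]$, is well defined (the sum is integrable) and $$\mathrm{Reg}(T)\le C\,B_1\Big(\sqrt{d\log(KT/\gamma)}+\sqrt\gamma\Big)\sqrt{KT\,d\log(KT/\gamma)}.$$ In particular, also $\mathrm{Reg}(T)\le C(1+\sqrt\gamma)\,B_1\,d\sqrt{KT}\,\log(KT/\gamma)$, which is $\tilde O(B_1d\sqrt{KT})$ for fixed $\gamma$. The bounds do not depend on the number of arms $m$ or on the minimum positive triggering probability. -/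

import Mathlib

open MeasureTheory ProbabilityTheory
open scoped Matrix

noncomputable section

/-- A feature map assigns a `d`-dimensional feature vector to each of the `m` base arms. -/
abbrev FeatureMap (m d : ℕ) : Type := Fin m → EuclideanSpace ℝ (Fin d)

/-- The vector of means `(⟨θ, φ(i)⟩)_i` of the base arms. -/
def meanVec {m d : ℕ} (θ : EuclideanSpace ℝ (Fin d)) (φ : FeatureMap m d) : Fin m → ℝ :=
  fun i => inner ℝ θ (φ i)

/-- The probability of the outcome vector `x` when the outcomes of the base arms are independent
Bernoulli variables with means `μ i` (meant for `μ ∈ [0,1]^m`). -/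
def bernoulliWeight {m : ℕ} (μ : Fin m → ℝ) (x : Fin m → Bool) : ℝ :=
  ∏ i, (if x i then μ i else 1 - μ i)

/-- The cube `[0,1]^m`. -/
def unitCube (m : ℕ) : Set (Fin m → ℝ) := {μ | ∀ i, μ i ∈ Set.Icc (0 : ℝ) 1}

/-- A contextual combinatorial bandit instance with probabilistically triggered arms:
base arms `Fin m`, action space `𝒮`, possible feature maps `Φ`, parameter space `Θ`,
triggering function `Dtrig S x` (the law of the triggered set when action `S` is played on the
outcome vector `x`), and non-negative reward `R S x A`. -/
structure C2MABT (m d : ℕ) (𝒮 : Type*) [MeasurableSpace 𝒮] where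
  Φ : Set (FeatureMap m d)
  Θ : Set (EuclideanSpace ℝ (Fin d))
  Dtrig : 𝒮 → (Fin m → Bool) → PMF (Finset (Fin m))
  R : 𝒮 → (Fin m → Bool) → Finset (Fin m) → ℝ
  norm_feature_le : ∀ φ ∈ Φ, ∀ i, ‖φ i‖ ≤ 1
  mean_mem : ∀ θ ∈ Θ, ∀ φ ∈ Φ, meanVec θ φ ∈ unitCube m
  R_nonneg : ∀ S x A, 0 ≤ R S x A
  measurable_Dtrig : ∀ x A, Measurable fun S => Dtrig S x A
  measurable_R : ∀ x A, Measurable fun S => R S x A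

namespace C2MABT

variable {m d : ℕ} {𝒮 : Type*} [MeasurableSpace 𝒮]

/-- Expected reward `r(S; μ)`: the expectation of `R(S, X, τ)` for independent Bernoulli outcomes
`X` with means `μ` and `τ ∼ Dtrig(S, X)`. -/
def r (I : C2MABT m d 𝒮) (S : 𝒮) (μ : Fin m → ℝ) : ℝ :=
  ∑ x : Fin m → Bool, ∑ A : Finset (Fin m),
    bernoulliWeight μ x * (I.Dtrig S x A).toReal * I.R S x A

/-- Triggering probability `p_i^{μ,S}`. -/
def trigProb (I : C2MABT m d 𝒮) (μ : Fin m → ℝ) (S : 𝒮) (i : Fin m) : ℝ :=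
  ∑ x : Fin m → Bool, ∑ A : Finset (Fin m),
    if i ∈ A then bernoulliWeight μ x * (I.Dtrig S x A).toReal else 0

/-- The set `𝓜` of all mean vectors generated by `Φ` and `Θ`. -/
def meanVectors (I : C2MABT m d 𝒮) : Set (Fin m → ℝ) :=
  {μ | ∃ θ ∈ I.Θ, ∃ φ ∈ I.Φ, μ = meanVec θ φ}

/-- The set of arms that can be triggered by the action `S`. -/
def canTrigger (I : C2MABT m d 𝒮) (S : 𝒮) : Set (Fin m) :=
  {i | ∃ μ ∈ I.meanVectors, 0 < I.trigProb μ S i}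

/-- The batch size `K`: the maximum over actions of the number of arms that can be triggered. -/
def batchSize (I : C2MABT m d 𝒮) : ℕ := ⨆ S : 𝒮, (I.canTrigger S).ncard

/-- The optimal expected reward `r(S*; μ)`. -/
def opt (I : C2MABT m d 𝒮) (μ : Fin m → ℝ) : ℝ := ⨆ S : 𝒮, I.r S μ

/-- The optimal expected reward is finite at every mean vector (in particular when a best action
exists). -/
def FiniteOpt (I : C2MABT m d 𝒮) : Prop :=
  ∀ μ ∈ unitCube m, BddAbove (Set.range fun S : 𝒮 => I.r S μ)

/-- Whether exactly the arms in `A` are triggered depends on the outcomes only through the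
outcomes of the arms in `A` themselves, i.e. through what is then revealed to the agent
(and on independent randomness). -/
def TriggeringByObserved (I : C2MABT m d 𝒮) : Prop :=
  ∀ (S : 𝒮) (A : Finset (Fin m)) (x y : Fin m → Bool),
    (∀ i ∈ A, x i = y i) → I.Dtrig S x A = I.Dtrig S y A

/-- Monotonicity. -/
def Monotonicity (I : C2MABT m d 𝒮) : Prop :=
  ∀ S : 𝒮, ∀ μ ∈ unitCube m, ∀ μ' ∈ unitCube m, (∀ i, μ i ≤ μ' i) → I.r S μ ≤ I.r S μ'

/-- 1-norm triggering probability modulated (TPM) `B₁`-bounded smoothness. -/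
def TPMSmooth (I : C2MABT m d 𝒮) (B₁ : ℝ) : Prop :=
  ∀ S : 𝒮, ∀ μ ∈ unitCube m, ∀ μ' ∈ unitCube m,
    |I.r S μ' - I.r S μ| ≤ B₁ * ∑ i, I.trigProb μ S i * |μ i - μ' i|

/-- `O` is an `(α, β)`-approximation oracle: on each input mean vector `μ` it outputs a (possibly
random) action `S` with `Pr[r(S; μ) ≥ α · r(S*; μ)] ≥ β`. -/
def IsApproxOracle (I : C2MABT m d 𝒮) (α β : ℝ) (O : Kernel (Fin m → ℝ) 𝒮) : Prop :=
  ∀ μ ∈ unitCube m, β ≤ (O μ).real {S | α * I.opt μ ≤ I.r S μ}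

end C2MABT

/-- The confidence radius
`ρ(δ) = √(log((γ + KT/d)^d / (γ^d δ²))) + √γ`. -/
def confRadius (d K T : ℕ) (γ δ : ℝ) : ℝ :=
  √(Real.log ((γ + K * T / d) ^ d / (γ ^ d * δ ^ 2))) + √γ

section Algorithm

variable {m d : ℕ}

/-- The Gram matrix in (0-based) round `t`, given feature maps `φ s` and triggered sets `τ s`. -/
def gram (γ : ℝ) (φ : ℕ → FeatureMap m d) (τ : ℕ → Finset (Fin m)) :
    ℕ → Matrix (Fin d) (Fin d) ℝ
  | 0 => γ • (1 : Matrix (Fin d) (Fin d) ℝ)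
  | t + 1 => gram γ φ τ t + ∑ i ∈ τ t, Matrix.vecMulVec (φ t i).ofLp (φ t i).ofLp

/-- The vector `b` in (0-based) round `t`. -/
def bVec (φ : ℕ → FeatureMap m d) (X : ℕ → Fin m → Bool) (τ : ℕ → Finset (Fin m)) :
    ℕ → (Fin d → ℝ)
  | 0 => 0
  | t + 1 => bVec φ X τ t + ∑ i ∈ τ t, (if X t i then (1 : ℝ) else 0) • (φ t i).ofLp

/-- The ridge regression estimate `G⁻¹ b`. -/
def thetaHat (γ : ℝ) (φ : ℕ → FeatureMap m d) (X : ℕ → Fin m → Bool) (τ : ℕ → Finset (Fin m))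
    (t : ℕ) : Fin d → ℝ :=
  (gram γ φ τ t)⁻¹.mulVec (bVec φ X τ t)

/-- The upper confidence bounds `⟨φ(i), θ̂⟩ + ρ ‖φ(i)‖_{G⁻¹}`, clipped to `[0,1]`. -/
def ucb (γ ρ : ℝ) (φ : ℕ → FeatureMap m d) (X : ℕ → Fin m → Bool) (τ : ℕ → Finset (Fin m))
    (t : ℕ) : Fin m → ℝ :=
  fun i => max 0 (min 1 ((φ t i).ofLp ⬝ᵥ thetaHat γ φ X τ t +
    ρ * √((φ t i).ofLp ⬝ᵥ (gram γ φ τ t)⁻¹.mulVec (φ t i).ofLp)))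

end Algorithm

section LearningProcess

variable {m d : ℕ} {𝒮 : Type*} [MeasurableSpace 𝒮] {Ω : Type*}

/-- The σ-algebra of the history before the action of round `t` is chosen: the feature maps,
actions, triggered sets and observed outcomes (unobserved ones are masked by `false`) of the
earlier rounds, and the feature map of round `t`. -/
@[reducible] def history (φ : ℕ → Ω → FeatureMap m d) (S : ℕ → Ω → 𝒮) (X : ℕ → Ω → Fin m → Bool)
    (τ : ℕ → Ω → Finset (Fin m)) (t : ℕ) : MeasurableSpace Ω :=
  (⨆ s, ⨆ (_ : s < t),
    (MeasurableSpace.comap (φ s) inferInstance ⊔ MeasurableSpace.comap (S s) inferInstance ⊔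
      MeasurableSpace.comap (τ s) inferInstance ⊔
      MeasurableSpace.comap (fun ω i => if i ∈ τ s ω then X s ω i else false) inferInstance)) ⊔
  MeasurableSpace.comap (φ t) inferInstance

/-- `φ, S, X, τ` are the feature maps, actions, outcomes and triggered sets of a `T`-round run of
the algorithm C²-UCB-T with oracle `O`, regularizer `γ` and failure probability `δ = 1/T`
against the instance `I` with true parameter `θ`. The feature maps may be random and chosen
adaptively. -/
structure IsC2UCBTRun [MeasurableSpace Ω] (P : Measure Ω) (I : C2MABT m d 𝒮)
    (θ : EuclideanSpace ℝ (Fin d)) (O : Kernel (Fin m → ℝ) 𝒮) (γ : ℝ) (T : ℕ)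
    (φ : ℕ → Ω → FeatureMap m d) (S : ℕ → Ω → 𝒮) (X : ℕ → Ω → Fin m → Bool)
    (τ : ℕ → Ω → Finset (Fin m)) : Prop where
  measurable_φ : ∀ t, Measurable (φ t)
  measurable_S : ∀ t, Measurable (S t)
  measurable_X : ∀ t, Measurable (X t)
  measurable_τ : ∀ t, Measurable (τ t)
  φ_mem : ∀ t < T, ∀ ω, φ t ω ∈ I.Φ
  /-- Given the history, the action is drawn by the oracle called on the UCB values. -/
  action_law : ∀ t < T, ∀ B : Set 𝒮, MeasurableSet B →
    P⟦S t ⁻¹' B | history φ S X τ t⟧ =ᵐ[P] fun ω =>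
      (O (ucb γ (confRadius d I.batchSize T γ (1 / T)) (fun s => φ s ω) (fun s => X s ω)
        (fun s => τ s ω) t)).real B
  /-- Given the history and the action, the outcomes are independent Bernoulli variables with
  means `⟨θ, φ_t(i)⟩`, and the triggered set is drawn from `Dtrig` at the action and outcomes. -/
  outcome_law : ∀ t < T, ∀ (x : Fin m → Bool) (A : Finset (Fin m)),
    P⟦{ω | X t ω = x ∧ τ t ω = A} |
        history φ S X τ t ⊔ MeasurableSpace.comap (S t) inferInstance⟧ =ᵐ[P] fun ω =>
      bernoulliWeight (meanVec θ (φ t ω)) x * (I.Dtrig (S t ω) x A).toReal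

/-- The pathwise cumulative difference whose expectation is the `(α, β)`-approximate regret. -/
def cumulativeGap (I : C2MABT m d 𝒮) (θ : EuclideanSpace ℝ (Fin d)) (α β : ℝ) (T : ℕ)
    (φ : ℕ → Ω → FeatureMap m d) (S : ℕ → Ω → 𝒮) (ω : Ω) : ℝ :=
  ∑ t ∈ Finset.range T,
    (α * β * I.opt (meanVec θ (φ t ω)) - I.r (S t ω) (meanVec θ (φ t ω)))

/-- The `T`-round `(α, β)`-approximate regret. -/
def approxRegret [MeasurableSpace Ω] (P : Measure Ω) (I : C2MABT m d 𝒮)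
    (θ : EuclideanSpace ℝ (Fin d)) (α β : ℝ) (T : ℕ)
    (φ : ℕ → Ω → FeatureMap m d) (S : ℕ → Ω → 𝒮) : ℝ :=
  ∫ ω, cumulativeGap I θ α β T φ S ω ∂P

end LearningProcess

end

/-! The proof is optimism plus the elliptical potential method, with triggering probabilities
absorbed by an identity in expectation. If `θ` lies in the confidence ellipsoid of round `t`, the
UCB vector `u` dominates the true means `μ`, so `opt μ ≤ opt u` by monotonicity. When the oracle
succeeds, `α * opt μ - r S μ ≤ r S u - r S μ`, and smoothness bounds this by `B₁` times the sum of
the clipped arm widths weighted by the triggering probabilities. The widths are determined by the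
history and the weights are conditional probabilities, so in expectation this is the sum over the
arms actually triggered (`integral_sum_trigProb_mul`), and no minimum triggering probability
appears. Oracle failures cost nothing: `opt μ` is determined by the history, so success keeps at
least a fraction `β` of its expectation, and the rewards lost are nonnegative.

Widths (`sum_sum_min_one_armWidth_le`): a whole batch multiplies the Gram determinant by at least `1
+ V`, with `V` the sum of its squared widths, so the sum of `log (1 + V)` is of order `d log`.
Rounds with `V ≤ 1` are handled by Cauchy–Schwarz. Rounds with `V > 1` require `K > γ`; they are few
and cost at most `K` each, which `K ≤ T` absorbs.

Confidence (`measure_confidence_fails_le`): the method of mixtures. The triggered set may depend on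
the outcomes, so the noise of the triggered arms need not be centred given that set. The exponential
process is still a supermartingale (`C2MABT.TriggeringByObserved.sum_exp_le_one`): for each `A` the
exponential factor tilts the means in `A`, and since the chance of triggering exactly `A` depends
only on outcomes in `A`, all other means may be tilted as well. The sum over `A` then becomes the
total mass of one probability law.

An ellipsoid fails at a fixed round with probability at most `1/T` and costs at most `2 B₁ K`. Over
`T` rounds this is `2 B₁ K`, so no bound uniform in time is needed. -/

noncomputable section

/-! ### Quadratic forms, determinants and traces of positive definite matrices. -/

section PositiveDefinite

variable {n : Type*} [Fintype n] [DecidableEq n]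

open scoped MatrixOrder in
theorem Matrix.PosDef.exists_eq_transpose_mul_self {G : Matrix n n ℝ} (hG : G.PosDef) :
    ∃ L : Matrix n n ℝ, L.det ≠ 0 ∧ G = Lᵀ * L := by
  obtain ⟨L, hL⟩ := CStarAlgebra.nonneg_iff_eq_star_mul_self.mp
    (Matrix.nonneg_iff_posSemidef.mpr hG.posSemidef)
  have hL' : G = Lᵀ * L := by
    rw [hL, Matrix.star_eq_conjTranspose, Matrix.conjTranspose_eq_transpose_of_trivial]
  refine ⟨L, fun h => ?_, hL'⟩
  have := hG.det_pos
  rw [hL', Matrix.det_mul, h, mul_zero] at this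
  exact lt_irrefl _ this

/-- Cauchy–Schwarz for the inner product defined by `G`, transported to the standard one by `G = Lᵀ
* L`. -/
theorem Matrix.PosDef.dotProduct_mulVec_sq_le {G : Matrix n n ℝ} (hG : G.PosDef) (x y : n → ℝ) :
    (x ⬝ᵥ G *ᵥ y) ^ 2 ≤ (x ⬝ᵥ G *ᵥ x) * (y ⬝ᵥ G *ᵥ y) := by
  obtain ⟨L, -, rfl⟩ := hG.exists_eq_transpose_mul_self
  have key : ∀ u v : n → ℝ, u ⬝ᵥ (Lᵀ * L) *ᵥ v = (L *ᵥ u) ⬝ᵥ (L *ᵥ v) := by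
    intro u v
    rw [← Matrix.mulVec_mulVec, Matrix.dotProduct_mulVec, Matrix.vecMul_transpose]
  rw [key, key, key]
  simpa [sq, dotProduct] using Finset.sum_mul_sq_le_sq_mul_sq Finset.univ (L *ᵥ x) (L *ᵥ y)

theorem Matrix.PosDef.abs_dotProduct_mulVec_le {G : Matrix n n ℝ} (hG : G.PosDef) (x y : n → ℝ) :
    |x ⬝ᵥ G *ᵥ y| ≤ √(x ⬝ᵥ G *ᵥ x) * √(y ⬝ᵥ G *ᵥ y) := by
  have hx : 0 ≤ x ⬝ᵥ G *ᵥ x := by simpa using hG.posSemidef.dotProduct_mulVec_nonneg x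
  rw [← Real.sqrt_mul hx]
  exact Real.abs_le_sqrt (hG.dotProduct_mulVec_sq_le x y)

theorem Matrix.PosDef.inv_quadForm_nonneg {G : Matrix n n ℝ} (hG : G.PosDef) (x : n → ℝ) :
    0 ≤ x ⬝ᵥ G⁻¹ *ᵥ x := by
  simpa using hG.inv.posSemidef.dotProduct_mulVec_nonneg x

theorem Matrix.PosDef.mulVec_inv_mulVec {G : Matrix n n ℝ} (hG : G.PosDef) (x : n → ℝ) :
    G *ᵥ (G⁻¹ *ᵥ x) = x := by
  rw [Matrix.mulVec_mulVec, Matrix.mul_nonsing_inv _ (isUnit_iff_ne_zero.mpr hG.det_pos.ne'),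
    Matrix.one_mulVec]

theorem Matrix.PosDef.inv_mulVec_mulVec {G : Matrix n n ℝ} (hG : G.PosDef) (x : n → ℝ) :
    G⁻¹ *ᵥ (G *ᵥ x) = x := by
  rw [Matrix.mulVec_mulVec, Matrix.nonsing_inv_mul _ (isUnit_iff_ne_zero.mpr hG.det_pos.ne'),
    Matrix.one_mulVec]

/-- If `G ≥ γ I` then `G⁻¹ ≤ γ⁻¹ I`, in terms of quadratic forms. -/
theorem Matrix.PosDef.inv_quadForm_le {G : Matrix n n ℝ} (hG : G.PosDef) {γ : ℝ} (hγ : 0 < γ)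
    (h : ∀ y : n → ℝ, γ * (y ⬝ᵥ y) ≤ y ⬝ᵥ G *ᵥ y) (x : n → ℝ) :
    x ⬝ᵥ G⁻¹ *ᵥ x ≤ (x ⬝ᵥ x) / γ := by
  set y := G⁻¹ *ᵥ x with hy
  have h1 : γ * (y ⬝ᵥ y) ≤ x ⬝ᵥ y := by
    have := h y
    rwa [hy, hG.mulVec_inv_mulVec, ← hy, dotProduct_comm y x] at this
  -- Expanding this square gives `2γ x·y ≤ x·x + γ² y·y`, and `h1` bounds the last term by `γ x·y`.
  have h2 : 0 ≤ (x - γ • y) ⬝ᵥ (x - γ • y) := by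
    simpa using dotProduct_star_self_nonneg (x - γ • y)
  have h3 : (x - γ • y) ⬝ᵥ (x - γ • y) = x ⬝ᵥ x - 2 * γ * (x ⬝ᵥ y) + γ * (γ * (y ⬝ᵥ y)) := by
    simp only [sub_dotProduct, dotProduct_sub, smul_dotProduct, dotProduct_smul, smul_eq_mul,
      dotProduct_comm y x]
    ring
  rw [le_div_iff₀ hγ]
  nlinarith [mul_le_mul_of_nonneg_left h1 hγ.le]

/-- AM–GM for the eigenvalues. -/
theorem Matrix.PosDef.det_le_trace_div_pow {G : Matrix n n ℝ} (hG : G.PosDef) :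
    G.det ≤ (G.trace / Fintype.card n) ^ Fintype.card n := by
  rcases isEmpty_or_nonempty n with h | h
  · simp
  have hc : (0 : ℝ) < Fintype.card n := by exact_mod_cast Fintype.card_pos
  have hnn : ∀ i ∈ Finset.univ, 0 ≤ hG.1.eigenvalues i := fun i _ => (hG.eigenvalues_pos i).le
  have h1 := Real.geom_mean_le_arith_mean Finset.univ (fun _ => 1) hG.1.eigenvalues
    (by simp) (by simpa using hc) hnn
  have h2 : G.det = ∏ i, hG.1.eigenvalues i := by simpa using hG.1.det_eq_prod_eigenvalues
  have h3 : G.trace = ∑ i, hG.1.eigenvalues i := by simpa using hG.1.trace_eq_sum_eigenvalues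
  simp only [Real.rpow_one, Finset.sum_const, Finset.card_univ, nsmul_eq_mul, mul_one, one_mul,
    ← h2, ← h3] at h1
  calc G.det = (G.det ^ (Fintype.card n : ℝ)⁻¹) ^ Fintype.card n := by
        rw [← Real.rpow_natCast, ← Real.rpow_mul hG.det_pos.le, inv_mul_cancel₀ hc.ne',
          Real.rpow_one]
    _ ≤ _ := pow_le_pow_left₀ (Real.rpow_nonneg hG.det_pos.le _) h1 _

theorem Finset.one_add_sum_le_prod_of_one_le {ι : Type*} (s : Finset ι) (f : ι → ℝ)
    (hf : ∀ i ∈ s, 1 ≤ f i) : 1 + ∑ i ∈ s, (f i - 1) ≤ ∏ i ∈ s, f i := by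
  classical
  induction s using Finset.induction_on with
  | empty => simp
  | insert a s ha ih =>
    rw [Finset.sum_insert ha, Finset.prod_insert ha]
    have h1 := ih fun i hi => hf i (Finset.mem_insert_of_mem hi)
    have h2 := hf a (Finset.mem_insert_self a s)
    have h3 : 0 ≤ ∑ i ∈ s, (f i - 1) :=
      Finset.sum_nonneg fun i hi => sub_nonneg.mpr (hf i (Finset.mem_insert_of_mem hi))
    nlinarith

/-- The eigenvalues of `1 + M` are at least `1`, and a product of such numbers is at least `1` plus
the sum of their excesses over `1`. -/
theorem Matrix.PosSemidef.one_add_trace_le_det {M : Matrix n n ℝ} (hM : M.PosSemidef) :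
    1 + M.trace ≤ (1 + M).det := by
  have hN : (1 + M).PosDef := Matrix.PosDef.one.add_posSemidef hM
  have h1 : ∀ i ∈ Finset.univ, 1 ≤ hN.1.eigenvalues i := by
    intro i _
    have hv : hN.1.eigenvectorBasis i ≠ 0 := (hN.1.eigenvectorBasis.orthonormal.ne_zero i)
    set v : n → ℝ := (hN.1.eigenvectorBasis i).ofLp with hvdef
    have hv0 : v ≠ 0 := fun h => hv (by ext j; exact congrFun h j)
    have hvv : 0 < v ⬝ᵥ v := by
      simpa using dotProduct_star_self_pos_iff.mpr hv0
    have e1 := hN.1.mulVec_eigenvectorBasis i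
    have e2 : 0 ≤ v ⬝ᵥ M *ᵥ v := by simpa using hM.dotProduct_mulVec_nonneg v
    have e3 : v ⬝ᵥ (1 + M) *ᵥ v = hN.1.eigenvalues i * (v ⬝ᵥ v) := by
      rw [e1, ← hvdef, dotProduct_smul, smul_eq_mul]
    rw [Matrix.add_mulVec, Matrix.one_mulVec, dotProduct_add] at e3
    nlinarith
  have h2 := Finset.one_add_sum_le_prod_of_one_le _ _ h1
  have h3 : (1 + M).det = ∏ i, hN.1.eigenvalues i := by simpa using hN.1.det_eq_prod_eigenvalues
  have h4 : (1 + M).trace = ∑ i, hN.1.eigenvalues i := by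
    simpa using hN.1.trace_eq_sum_eigenvalues
  rw [Finset.sum_sub_distrib, ← h4, ← h3, Matrix.trace_add, Matrix.trace_one] at h2
  simp only [Finset.sum_const, Finset.card_univ, nsmul_eq_mul, mul_one] at h2
  linarith

/-- A replacement for the rank-one determinant lemma that treats a whole batch `S` at once. With `G
= Lᵀ * L` the claim reduces to `1 + M` for the congruent matrix `M = L⁻ᵀ S L⁻¹`, which has the same
trace as `G⁻¹ * S`. -/
theorem Matrix.PosDef.det_mul_one_add_trace_le {G S : Matrix n n ℝ} (hG : G.PosDef)
    (hS : S.PosSemidef) : G.det * (1 + (G⁻¹ * S).trace) ≤ (G + S).det := by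
  obtain ⟨L, hL, rfl⟩ := hG.exists_eq_transpose_mul_self
  have hu : IsUnit L.det := isUnit_iff_ne_zero.mpr hL
  have hut : IsUnit Lᵀ.det := by rwa [Matrix.det_transpose]
  set M : Matrix n n ℝ := (L⁻¹)ᵀ * S * L⁻¹ with hM
  have hMpsd : M.PosSemidef := by
    simpa using hS.conjTranspose_mul_mul_same L⁻¹
  have e1 : Lᵀ * L + S = Lᵀ * (1 + M) * L := by
    rw [hM, Matrix.mul_add, Matrix.add_mul, Matrix.mul_one, Matrix.transpose_nonsing_inv]
    congr 1
    rw [Matrix.mul_assoc, Matrix.mul_assoc, Matrix.mul_assoc, Matrix.nonsing_inv_mul _ hu,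
      Matrix.mul_one, Matrix.mul_nonsing_inv_cancel_left _ _ hut]
  have e2 : ((Lᵀ * L)⁻¹ * S).trace = M.trace := by
    rw [Matrix.mul_inv_rev, Matrix.mul_assoc, Matrix.trace_mul_comm, hM,
      Matrix.transpose_nonsing_inv]
  rw [e1, e2, Matrix.det_mul, Matrix.det_mul, Matrix.det_mul, Matrix.det_transpose]
  have := hMpsd.one_add_trace_le_det
  nlinarith [mul_self_nonneg L.det]

omit [DecidableEq n] in
theorem Matrix.trace_mul_vecMulVec_self (M : Matrix n n ℝ) (x : n → ℝ) :
    (M * Matrix.vecMulVec x x).trace = x ⬝ᵥ M *ᵥ x := by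
  rw [Matrix.mul_vecMulVec, Matrix.trace_vecMulVec, dotProduct_comm]

end PositiveDefinite

/-! ### Gaussian integrals for the method of mixtures. -/

section GaussianMixture

variable {n : Type*} [Fintype n] [DecidableEq n]

/-- The mass of the standard Gaussian weight. -/
def gaussianMass (n : Type*) [Fintype n] : ENNReal :=
  ∫⁻ u : n → ℝ, ENNReal.ofReal (Real.exp (-(u ⬝ᵥ u) / 2))

omit [DecidableEq n] in
theorem integrable_exp_neg_half_dotProduct :
    Integrable fun u : n → ℝ => Real.exp (-(u ⬝ᵥ u) / 2) := by
  have h : (fun u : n → ℝ => Real.exp (-(u ⬝ᵥ u) / 2)) =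
      fun u => ∏ i, Real.exp (-(1 / 2) * (u i) ^ 2) := by
    funext u
    rw [← Real.exp_sum, ← Finset.mul_sum, dotProduct]
    simp only [sq]
    ring_nf
  rw [h]
  exact Integrable.fintype_prod (f := fun _ x => Real.exp (-(1 / 2) * x ^ 2))
    fun _ => integrable_exp_neg_mul_sq (by norm_num)

omit [DecidableEq n] in
-- The value of the mass is never needed: it occurs on both sides of the mixture inequality and
-- cancels once it is known to be finite and nonzero.
theorem gaussianMass_ne_top : gaussianMass n ≠ ⊤ :=
  (integrable_exp_neg_half_dotProduct (n := n)).lintegral_lt_top.ne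

omit [DecidableEq n] in
theorem gaussianMass_ne_zero : gaussianMass n ≠ 0 := by
  have hf : Measurable fun u : n → ℝ => ENNReal.ofReal (Real.exp (-(u ⬝ᵥ u) / 2)) := by
    unfold dotProduct; fun_prop
  refine ((lintegral_pos_iff_support hf).mpr ?_).ne'
  have : Function.support (fun u : n → ℝ => ENNReal.ofReal (Real.exp (-(u ⬝ᵥ u) / 2))) =
      Set.univ := by
    ext u
    simp [Real.exp_pos]
  rw [this]
  exact Measure.measure_univ_pos.mpr (NeZero.ne _)

/-- The substitution `u = L v` with `G = Lᵀ * L` has Jacobian `|det L| = √(det G)`. -/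
theorem Matrix.PosDef.lintegral_gaussian {G : Matrix n n ℝ} (hG : G.PosDef) :
    ∫⁻ v : n → ℝ, ENNReal.ofReal (Real.exp (-(v ⬝ᵥ G *ᵥ v) / 2)) =
      ENNReal.ofReal (√G.det)⁻¹ * gaussianMass n := by
  obtain ⟨L, hL, rfl⟩ := hG.exists_eq_transpose_mul_self
  have key : ∀ u : n → ℝ, u ⬝ᵥ (Lᵀ * L) *ᵥ u = (Matrix.toLin' L u) ⬝ᵥ (Matrix.toLin' L u) := by
    intro u
    rw [← Matrix.mulVec_mulVec, Matrix.dotProduct_mulVec, Matrix.vecMul_transpose,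
      Matrix.toLin'_apply]
  have hm : Measurable (Matrix.toLin' L) :=
    (LinearMap.continuous_of_finiteDimensional _).measurable
  have hf : Measurable fun u : n → ℝ => ENNReal.ofReal (Real.exp (-(u ⬝ᵥ u) / 2)) := by
    unfold dotProduct; fun_prop
  simp only [key]
  rw [← lintegral_map hf hm, Real.map_matrix_volume_pi_eq_smul_volume_pi hL, lintegral_smul_measure,
    Matrix.det_mul, Matrix.det_transpose, Real.sqrt_mul_self_eq_abs, abs_inv, smul_eq_mul]
  rfl

/-- Complete the square around `G⁻¹ s` and use translation invariance. The exponent left over is the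
self-normalized quantity to be controlled. -/
theorem Matrix.PosDef.lintegral_gaussian_tilted {G : Matrix n n ℝ} (hG : G.PosDef) (s : n → ℝ) :
    ∫⁻ v : n → ℝ, ENNReal.ofReal (Real.exp (v ⬝ᵥ s - (v ⬝ᵥ G *ᵥ v) / 2)) =
      ENNReal.ofReal (Real.exp ((s ⬝ᵥ G⁻¹ *ᵥ s) / 2) * (√G.det)⁻¹) * gaussianMass n := by
  have hGt : Gᵀ = G := hG.1
  have key : ∀ v : n → ℝ, ENNReal.ofReal (Real.exp (v ⬝ᵥ s - (v ⬝ᵥ G *ᵥ v) / 2)) =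
      ENNReal.ofReal (Real.exp ((s ⬝ᵥ G⁻¹ *ᵥ s) / 2)) *
        ENNReal.ofReal (Real.exp (-((v - G⁻¹ *ᵥ s) ⬝ᵥ G *ᵥ (v - G⁻¹ *ᵥ s)) / 2)) := by
    intro v
    rw [← ENNReal.ofReal_mul (Real.exp_pos _).le, ← Real.exp_add]
    congr 2
    have e : (G⁻¹ *ᵥ s) ⬝ᵥ G *ᵥ v = s ⬝ᵥ v := by
      rw [Matrix.dotProduct_mulVec, ← Matrix.mulVec_transpose, hGt, hG.mulVec_inv_mulVec]
    rw [Matrix.mulVec_sub, hG.mulVec_inv_mulVec, sub_dotProduct, dotProduct_sub, dotProduct_sub,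
      e, dotProduct_comm s v, dotProduct_comm (G⁻¹ *ᵥ s) s]
    ring
  simp only [key]
  rw [lintegral_const_mul' _ _ ENNReal.ofReal_ne_top, lintegral_sub_right_eq_self
    (fun v : n → ℝ => ENNReal.ofReal (Real.exp (-(v ⬝ᵥ G *ᵥ v) / 2))) (G⁻¹ *ᵥ s),
    hG.lintegral_gaussian, ENNReal.ofReal_mul (Real.exp_pos _).le, mul_assoc]

end GaussianMixture

/-! ### Integrals against conditional probabilities and conditional laws. -/

section Conditioning

/-- `P` restricted to `F` and `P` with density the conditional probability of `F` agree on the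
sub-σ-algebra, hence integrate every `m`-measurable `h` equally. Working with `ENNReal` values
avoids any integrability assumption. -/
theorem setLIntegral_eq_lintegral_mul_of_condExp {Ω : Type*} {m m₀ : MeasurableSpace Ω}
    (hm : m ≤ m₀) {P : Measure Ω} [IsFiniteMeasure P] {F : Set Ω} (hF : MeasurableSet F)
    {q : Ω → ℝ} (hq : P⟦F | m⟧ =ᵐ[P] q) {h : Ω → ENNReal} (hh : Measurable[m] h) :
    ∫⁻ ω in F, h ω ∂P = ∫⁻ ω, h ω * ENNReal.ofReal (q ω) ∂P := by
  set c : Ω → ℝ := P⟦F | m⟧ with hc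
  have hcm : Measurable[m] c := stronglyMeasurable_condExp.measurable
  have hcm' : Measurable c := hcm.mono hm le_rfl
  have hint : Integrable (F.indicator fun _ => (1 : ℝ)) P :=
    (integrable_const (1 : ℝ)).indicator hF
  have hc0 : 0 ≤ᵐ[P] c := condExp_nonneg (Filter.Eventually.of_forall fun ω =>
    Set.indicator_nonneg (fun _ _ => zero_le_one) ω)
  have hcint : Integrable c P := integrable_condExp
  have htrim : (P.restrict F).trim hm =
      (P.withDensity fun ω => ENNReal.ofReal (c ω)).trim hm := by
    refine @Measure.ext _ m _ _ fun s hs => ?_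
    rw [trim_measurableSet_eq hm hs, trim_measurableSet_eq hm hs, withDensity_apply _ (hm s hs),
      Measure.restrict_apply (hm s hs),
      ← ofReal_integral_eq_lintegral_ofReal hcint.restrict (ae_restrict_of_ae hc0),
      setIntegral_condExp hm hint hs, integral_indicator hF, Measure.restrict_restrict hF]
    simp [Measure.real, Set.inter_comm]
  calc ∫⁻ ω in F, h ω ∂P = ∫⁻ ω, h ω ∂(P.withDensity fun ω => ENNReal.ofReal (c ω)) := by
        rw [← lintegral_trim hm hh, htrim, lintegral_trim hm hh]
    _ = ∫⁻ ω, ENNReal.ofReal (c ω) * h ω ∂P :=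
        lintegral_withDensity_eq_lintegral_mul _ hcm'.ennreal_ofReal (hh.mono hm le_rfl)
    _ = ∫⁻ ω, h ω * ENNReal.ofReal (q ω) ∂P := by
        refine lintegral_congr_ae ?_
        filter_upwards [hq] with ω hω
        rw [hω, mul_comm]

/-- If the conditional law of `S` given `m` is `κ (Y ω)` with `Y` measurable with respect to `m`,
then the conditional law of `(Y, S)` is that of `(Y, κ Y)`. -/
theorem setLIntegral_prod_eq_lintegral_mul_of_condExp {Ω E F : Type*} {m m₀ : MeasurableSpace Ω}
    [MeasurableSpace E] [MeasurableSpace F] (hm : m ≤ m₀) {P : Measure Ω} [IsFiniteMeasure P]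
    {Y : Ω → E} (hY : Measurable[m] Y) {S : Ω → F} (hS : Measurable S) (κ : Kernel E F)
    [IsMarkovKernel κ]
    (hκ : ∀ B : Set F, MeasurableSet B → P⟦S ⁻¹' B | m⟧ =ᵐ[P] fun ω => (κ (Y ω)).real B)
    {h : Ω → ENNReal} (hh : Measurable[m] h) (hfin : ∫⁻ ω, h ω ∂P ≠ ⊤)
    {D : Set (E × F)} (hD : MeasurableSet D) :
    ∫⁻ ω in {ω | (Y ω, S ω) ∈ D}, h ω ∂P =
      ∫⁻ ω, h ω * κ (Y ω) (Prod.mk (Y ω) ⁻¹' D) ∂P := by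
  have hY' : Measurable Y := hY.mono hm le_rfl
  have hh' : Measurable h := hh.mono hm le_rfl
  have hYS : Measurable fun ω => (Y ω, S ω) := hY'.prodMk hS
  -- Absorbing `h` into a finite measure turns the claim into an equality of two measures on the
  -- product, which can be checked on rectangles.
  set Q := P.withDensity h with hQ
  have : IsFiniteMeasure Q := isFiniteMeasure_withDensity hfin
  have key : Q.map (fun ω => (Y ω, S ω)) = (Q.map Y) ⊗ₘ κ := by
    refine Measure.ext_prod fun {s t} hs ht => ?_
    have hκm : Measurable fun ω => κ (Y ω) t := (κ.measurable_coe ht).comp hY'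
    have hF := setLIntegral_eq_lintegral_mul_of_condExp hm (hS ht) (hκ t ht)
      (hh.indicator (hY hs))
    rw [lintegral_indicator (hY' hs), Measure.restrict_restrict (hY' hs)] at hF
    rw [Measure.map_apply hYS (hs.prod ht), Measure.compProd_apply_prod hs ht,
      setLIntegral_map hs (κ.measurable_coe ht) hY', hQ, withDensity_apply _ (hYS (hs.prod ht)),
      setLIntegral_withDensity_eq_setLIntegral_mul _ hh' hκm (hY' hs),
      ← lintegral_indicator (hY' hs)]
    refine hF.trans (lintegral_congr fun ω => ?_)
    by_cases hω : ω ∈ Y ⁻¹' s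
    · simp [Set.indicator_of_mem hω]
    · simp [Set.indicator_of_notMem hω]
  have h1 := congrArg (fun μ : Measure (E × F) => μ D) key
  simp only [Measure.map_apply hYS hD, Measure.compProd_apply hD] at h1
  have hκm : Measurable fun ω => κ (Y ω) (Prod.mk (Y ω) ⁻¹' D) :=
    (Kernel.measurable_kernel_prodMk_left hD).comp hY'
  rw [lintegral_map (Kernel.measurable_kernel_prodMk_left hD) hY', hQ,
    withDensity_apply _ (hYS hD), lintegral_withDensity_eq_lintegral_mul _ hh' hκm] at h1
  exact h1

end Conditioning

/-! ### Products of Bernoulli weights. -/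

section Bernoulli

variable {m : ℕ}

theorem bernoulliWeight_nonneg {μ : Fin m → ℝ} (hμ : μ ∈ unitCube m) (x : Fin m → Bool) :
    0 ≤ bernoulliWeight μ x := by
  refine Finset.prod_nonneg fun i _ => ?_
  split_ifs
  · exact (hμ i).1
  · linarith [(hμ i).2]

theorem sum_bernoulliWeight (μ : Fin m → ℝ) : ∑ x, bernoulliWeight μ x = 1 := by
  have h := Finset.prod_univ_sum (fun _ : Fin m => (Finset.univ : Finset Bool))
    (fun i b => if b then μ i else 1 - μ i)
  simp only [Fintype.piFinset_univ] at h
  simp only [bernoulliWeight, ← h]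
  simp

/-- The expectation of a function of the outcomes in `A` depends only on the means in `A`. -/
theorem sum_bernoulliWeight_mul_congr {A : Finset (Fin m)} {μ ν : Fin m → ℝ}
    (hμν : ∀ i ∈ A, μ i = ν i) {g : (Fin m → Bool) → ℝ}
    (hg : ∀ x y, (∀ i ∈ A, x i = y i) → g x = g y) :
    ∑ x, bernoulliWeight μ x * g x = ∑ x, bernoulliWeight ν x * g x := by
  -- On a fibre of the mask `g` is constant, and the fibre is a box on which the coordinates outside
  -- `A` sum out to `1`. Patterns that are true somewhere outside `A` have empty fibres.
  let mask : (Fin m → Bool) → (Fin m → Bool) := fun x i => if i ∈ A then x i else false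
  rw [← Finset.sum_fiberwise Finset.univ mask fun x => bernoulliWeight μ x * g x,
    ← Finset.sum_fiberwise Finset.univ mask fun x => bernoulliWeight ν x * g x]
  refine Finset.sum_congr rfl fun a _ => ?_
  have hga : ∀ x ∈ ({x | mask x = a} : Finset (Fin m → Bool)), g x = g a := by
    intro x hx
    refine hg _ _ fun i hi => ?_
    have := congrFun (Finset.mem_filter.mp hx).2 i
    simpa [mask, hi] using this
  have hfac : ∀ f : (Fin m → Bool) → ℝ, ∑ x with mask x = a, f x * g x =
      (∑ x with mask x = a, f x) * g a := by
    intro f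
    rw [Finset.sum_mul]
    exact Finset.sum_congr rfl fun x hx => by rw [hga x hx]
  rw [hfac, hfac]
  congr 1
  by_cases ha : ∀ i, i ∉ A → a i = false
  · have e : ({x | mask x = a} : Finset (Fin m → Bool)) =
        Fintype.piFinset fun i => if i ∈ A then {a i} else Finset.univ := by
      ext x
      simp only [Finset.mem_filter, Finset.mem_univ, true_and, Fintype.mem_piFinset, funext_iff,
        mask]
      refine forall_congr' fun i => ?_
      by_cases hi : i ∈ A
      · simp [hi]
      · simp [hi, ha i hi]
    rw [e]
    simp only [bernoulliWeight]
    rw [← Finset.prod_univ_sum (fun i => if i ∈ A then {a i} else Finset.univ)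
      (fun i b => if b then μ i else 1 - μ i), ← Finset.prod_univ_sum
      (fun i => if i ∈ A then {a i} else Finset.univ) (fun i b => if b then ν i else 1 - ν i)]
    refine Finset.prod_congr rfl fun i _ => ?_
    by_cases hi : i ∈ A
    · simp [hi, hμν i hi]
    · simp [hi]
  · push Not at ha
    obtain ⟨i, hi, hai⟩ := ha
    have e : ({x | mask x = a} : Finset (Fin m → Bool)) = ∅ := by
      refine Finset.filter_eq_empty_iff.mpr fun x _ hx => hai ?_
      have := congrFun hx i
      simpa [mask, hi] using this.symm
    simp [e]

/-- Hoeffding's lemma for the two-point law, with `l² / 8` relaxed to `l² / 2` so that the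
compensator of the exponential process is half the unscaled Gram form. -/
theorem bernoulli_mgf_le {p : ℝ} (hp : p ∈ Set.Icc (0 : ℝ) 1) (l : ℝ) :
    p * Real.exp (l * (1 - p)) + (1 - p) * Real.exp (l * (0 - p)) ≤ Real.exp (l ^ 2 / 2) := by
  have hp0 := hp.1
  have hp1 : 0 ≤ 1 - p := by linarith [hp.2]
  let P : Measure ℝ := ENNReal.ofReal p • Measure.dirac 1 + ENNReal.ofReal (1 - p) • Measure.dirac 0
  have hP : IsProbabilityMeasure P := ⟨by
    simp [P, ← ENNReal.ofReal_add hp0 hp1]⟩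
  have hint : ∀ f : ℝ → ℝ, ∫ x, f x ∂P = p * f 1 + (1 - p) * f 0 := by
    intro f
    rw [integral_add_measure ((integrable_dirac (by simp)).smul_measure ENNReal.ofReal_ne_top)
      ((integrable_dirac (by simp)).smul_measure ENNReal.ofReal_ne_top), integral_smul_measure,
      integral_smul_measure, integral_dirac, integral_dirac, ENNReal.toReal_ofReal hp0,
      ENNReal.toReal_ofReal hp1, smul_eq_mul, smul_eq_mul]
  have hb : ∀ᵐ x ∂P, (id x : ℝ) ∈ Set.Icc (0 : ℝ) 1 := by
    rw [ae_add_measure_iff]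
    refine ⟨Measure.ae_smul_measure ?_ _, Measure.ae_smul_measure ?_ _⟩ <;>
    · exact (ae_dirac_iff (measurable_id measurableSet_Icc)).mpr (by simp)
  have h := (hasSubgaussianMGF_of_mem_Icc (X := id) measurable_id.aemeasurable hb).mgf_le l
  have hmean : ∫ x, id x ∂P = p := by rw [hint]; simp
  rw [mgf, hmean, hint] at h
  refine h.trans (Real.exp_le_exp.mpr ?_)
  simp
  nlinarith [sq_nonneg l]

end Bernoulli

/-! ### The exponential inequality under outcome-dependent triggering. -/

section Instance

variable {m d : ℕ} {𝒮 : Type*} [MeasurableSpace 𝒮] (I : C2MABT m d 𝒮)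

theorem C2MABT.sum_Dtrig (S : 𝒮) (x : Fin m → Bool) : ∑ A, (I.Dtrig S x A).toReal = 1 := by
  rw [← ENNReal.toReal_sum fun A _ => PMF.apply_ne_top _ _, ← tsum_fintype (L := .unconditional _),
    PMF.tsum_coe]
  simp

variable {I}

/-- This is where `TriggeringByObserved` enters. The exponential factor of a set `A` is dominated by
a change of the Bernoulli means in `A` from `μ` to `ν`. One `ν` serves all sets `A`, so the total is
the mass of the law with means `ν`. -/
theorem C2MABT.TriggeringByObserved.sum_exp_le_one (hI : I.TriggeringByObserved) (S : 𝒮)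
    {μ : Fin m → ℝ} (hμ : μ ∈ unitCube m) (l : Fin m → ℝ) :
    ∑ x : Fin m → Bool, ∑ A : Finset (Fin m), bernoulliWeight μ x * (I.Dtrig S x A).toReal *
      Real.exp (∑ i ∈ A, (l i * ((if x i then 1 else 0) - μ i) - l i ^ 2 / 2)) ≤ 1 := by
  set z : Fin m → ℝ := fun i =>
    μ i * Real.exp (l i * (1 - μ i)) + (1 - μ i) * Real.exp (l i * (0 - μ i)) with hz
  have hzpos : ∀ i, 0 < z i := by
    intro i
    rcases (hμ i).1.eq_or_lt with h0 | h0
    · simp only [hz, ← h0]; simp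
    · have : 0 ≤ 1 - μ i := by linarith [(hμ i).2]
      simp only [hz]; positivity
  have hzle : ∀ i, z i ≤ Real.exp (l i ^ 2 / 2) := fun i => bernoulli_mgf_le (hμ i) (l i)
  -- The exponentially tilted mean; `z i` is the normalizer, at most `exp (l i ^ 2 / 2)` by
  -- Hoeffding.
  set ν : Fin m → ℝ := fun i => μ i * Real.exp (l i * (1 - μ i)) / z i with hν
  have hν' : ∀ i, 1 - ν i = (1 - μ i) * Real.exp (l i * (0 - μ i)) / z i := by
    intro i
    rw [hν]
    simp only
    rw [eq_div_iff (hzpos i).ne', sub_mul, div_mul_cancel₀ _ (hzpos i).ne', hz]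
    ring
  have htilt : ∀ (A : Finset (Fin m)) (x : Fin m → Bool), bernoulliWeight μ x *
      Real.exp (∑ i ∈ A, (l i * ((if x i then 1 else 0) - μ i) - l i ^ 2 / 2)) ≤
      bernoulliWeight (fun i => if i ∈ A then ν i else μ i) x := by
    intro A x
    have e : Real.exp (∑ i ∈ A, (l i * ((if x i then 1 else 0) - μ i) - l i ^ 2 / 2)) =
        ∏ i, if i ∈ A then
          Real.exp (l i * ((if x i then 1 else 0) - μ i)) / Real.exp (l i ^ 2 / 2) else 1 := by
      rw [Real.exp_sum, Finset.prod_ite_mem, Finset.univ_inter]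
      exact Finset.prod_congr rfl fun i _ => Real.exp_sub _ _
    rw [e, bernoulliWeight, bernoulliWeight, ← Finset.prod_mul_distrib]
    refine Finset.prod_le_prod (fun i _ => ?_) fun i _ => ?_
    · have h0 := (hμ i).1
      have h1 : 0 ≤ 1 - μ i := by linarith [(hμ i).2]
      split_ifs <;> positivity
    · have h0 := (hμ i).1
      have h1 : 0 ≤ 1 - μ i := by linarith [(hμ i).2]
      by_cases hi : i ∈ A
      · by_cases hx : x i
        · simp only [hi, hx, if_true, hν, ← mul_div_assoc]
          exact div_le_div_of_nonneg_left (by positivity) (hzpos i) (hzle i)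
        · simp only [hi, hx, if_true, if_false, hν', ← mul_div_assoc, Bool.false_eq_true]
          exact div_le_div_of_nonneg_left (by positivity) (hzpos i) (hzle i)
      · simp [hi]
  calc _ ≤ ∑ x : Fin m → Bool, ∑ A : Finset (Fin m),
        bernoulliWeight (fun i => if i ∈ A then ν i else μ i) x * (I.Dtrig S x A).toReal := by
        refine Finset.sum_le_sum fun x _ => Finset.sum_le_sum fun A _ => ?_
        rw [mul_right_comm]
        exact mul_le_mul_of_nonneg_right (htilt A x) ENNReal.toReal_nonneg
    -- For fixed `A` the factor `Dtrig S x A` depends only on the outcomes in `A`, so the means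
    -- outside `A` may be changed to `ν` for free.
    _ = ∑ A : Finset (Fin m), ∑ x : Fin m → Bool, bernoulliWeight ν x * (I.Dtrig S x A).toReal := by
        rw [Finset.sum_comm]
        refine Finset.sum_congr rfl fun A _ => ?_
        refine sum_bernoulliWeight_mul_congr (A := A) (fun i hi => by simp [hi]) fun x y hxy => ?_
        rw [hI S A x y hxy]
    _ = 1 := by
        rw [Finset.sum_comm]
        simp only [← Finset.mul_sum, I.sum_Dtrig, mul_one, sum_bernoulliWeight]

end Instance

/-! ### Pathwise analysis: elliptical potential, confidence widths and optimism. -/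

section Deterministic

variable {m d : ℕ}

theorem meanVec_eq_dotProduct (θ : EuclideanSpace ℝ (Fin d)) (φ : FeatureMap m d) (i : Fin m) :
    meanVec θ φ i = (φ i).ofLp ⬝ᵥ θ.ofLp := by
  simp [meanVec, EuclideanSpace.inner_eq_star_dotProduct]

theorem EuclideanSpace.dotProduct_self_le_one {x : EuclideanSpace ℝ (Fin d)} (hx : ‖x‖ ≤ 1) :
    x.ofLp ⬝ᵥ x.ofLp ≤ 1 := by
  have h : x.ofLp ⬝ᵥ x.ofLp = ‖x‖ ^ 2 := by
    rw [EuclideanSpace.real_norm_sq_eq]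
    simp [dotProduct, sq]
  rw [h]
  exact pow_le_one₀ (norm_nonneg _) hx

theorem posSemidef_sum_vecMulVec (A : Finset (Fin m)) (φ : FeatureMap m d) :
    (∑ i ∈ A, Matrix.vecMulVec (φ i).ofLp (φ i).ofLp).PosSemidef :=
  Matrix.posSemidef_sum _ fun i _ => by
    simpa using Matrix.posSemidef_vecMulVec_self_star (φ i).ofLp

theorem gram_posDef {γ : ℝ} (hγ : 0 < γ) (φ : ℕ → FeatureMap m d) (τ : ℕ → Finset (Fin m))
    (t : ℕ) : (gram γ φ τ t).PosDef := by
  induction t with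
  | zero => exact Matrix.PosDef.one.smul hγ
  | succ t ih => exact ih.add_posSemidef (posSemidef_sum_vecMulVec _ _)

theorem dotProduct_vecMulVec_self_mulVec (x y : Fin d → ℝ) :
    y ⬝ᵥ Matrix.vecMulVec x x *ᵥ y = (y ⬝ᵥ x) ^ 2 := by
  rw [Matrix.vecMulVec_mulVec, op_smul_eq_smul, dotProduct_smul, smul_eq_mul, dotProduct_comm x y,
    sq]

theorem dotProduct_gram_succ_mulVec (γ : ℝ) (φ : ℕ → FeatureMap m d) (τ : ℕ → Finset (Fin m))
    (t : ℕ) (y : Fin d → ℝ) : y ⬝ᵥ gram γ φ τ (t + 1) *ᵥ y =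
      y ⬝ᵥ gram γ φ τ t *ᵥ y + ∑ i ∈ τ t, (y ⬝ᵥ (φ t i).ofLp) ^ 2 := by
  rw [gram, Matrix.add_mulVec, dotProduct_add, Matrix.sum_mulVec, dotProduct_sum]
  simp only [dotProduct_vecMulVec_self_mulVec]

theorem mul_dotProduct_le_gram (γ : ℝ) (φ : ℕ → FeatureMap m d) (τ : ℕ → Finset (Fin m))
    (t : ℕ) (y : Fin d → ℝ) : γ * (y ⬝ᵥ y) ≤ y ⬝ᵥ gram γ φ τ t *ᵥ y := by
  induction t with
  | zero => simp [gram, Matrix.smul_mulVec]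
  | succ t ih =>
    rw [dotProduct_gram_succ_mulVec]
    exact ih.trans (le_add_of_nonneg_right (Finset.sum_nonneg fun _ _ => sq_nonneg _))

theorem gram_inv_quadForm_le {γ : ℝ} (hγ : 0 < γ) (φ : ℕ → FeatureMap m d)
    (τ : ℕ → Finset (Fin m)) (t : ℕ) {x : EuclideanSpace ℝ (Fin d)} (hx : ‖x‖ ≤ 1) :
    x.ofLp ⬝ᵥ (gram γ φ τ t)⁻¹ *ᵥ x.ofLp ≤ 1 / γ :=
  ((gram_posDef hγ φ τ t).inv_quadForm_le hγ (mul_dotProduct_le_gram γ φ τ t) _).trans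
    (div_le_div_of_nonneg_right (EuclideanSpace.dotProduct_self_le_one hx) hγ.le)

theorem trace_gram_le {γ : ℝ} {φ : ℕ → FeatureMap m d} {τ : ℕ → Finset (Fin m)} {K t : ℕ}
    (hφ : ∀ s < t, ∀ i, ‖φ s i‖ ≤ 1) (hτ : ∀ s < t, (τ s).card ≤ K) :
    (gram γ φ τ t).trace ≤ d * γ + K * t := by
  induction t with
  | zero => simp [gram, Matrix.trace_smul, mul_comm]
  | succ t ih =>
    have h1 := ih (fun s hs => hφ s (hs.trans t.lt_succ_self))
      (fun s hs => hτ s (hs.trans t.lt_succ_self))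
    have h2 : (∑ i ∈ τ t, Matrix.vecMulVec (φ t i).ofLp (φ t i).ofLp).trace ≤ K := by
      rw [Matrix.trace_sum]
      calc _ ≤ ∑ i ∈ τ t, (1 : ℝ) := Finset.sum_le_sum fun i _ => by
            rw [Matrix.trace_vecMulVec]
            exact EuclideanSpace.dotProduct_self_le_one (hφ t t.lt_succ_self i)
        _ ≤ K := by simpa using hτ t t.lt_succ_self
    rw [gram, Matrix.trace_add]
    push_cast
    linarith

theorem det_gram_le {γ : ℝ} (hγ : 0 < γ) {φ : ℕ → FeatureMap m d} {τ : ℕ → Finset (Fin m)}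
    {K t T : ℕ} (htT : t ≤ T) (hφ : ∀ s < t, ∀ i, ‖φ s i‖ ≤ 1) (hτ : ∀ s < t, (τ s).card ≤ K) :
    (gram γ φ τ t).det ≤ (γ + K * T / d) ^ d := by
  have hG := gram_posDef hγ φ τ t
  have h := hG.det_le_trace_div_pow
  rw [Fintype.card_fin] at h
  refine h.trans (pow_le_pow_left₀ (div_nonneg hG.posSemidef.trace_nonneg d.cast_nonneg) ?_ _)
  rcases d.eq_zero_or_pos with rfl | hd
  · simp [hγ.le]
  have hd' : (0 : ℝ) < d := by exact_mod_cast hd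
  rw [div_le_iff₀ hd', add_mul, div_mul_cancel₀ _ hd'.ne', mul_comm γ]
  refine (trace_gram_le hφ hτ).trans (add_le_add_right ?_ _)
  exact mul_le_mul_of_nonneg_left (by exact_mod_cast htT) K.cast_nonneg

theorem det_gram_zero (γ : ℝ) (φ : ℕ → FeatureMap m d) (τ : ℕ → Finset (Fin m)) :
    (gram γ φ τ 0).det = γ ^ d := by
  simp [gram]

/-- The total squared width `∑_{i ∈ τ_t} ‖φ_t(i)‖²_{G_t⁻¹}` of the arms triggered in round `t`. -/
def batchWidth (γ : ℝ) (φ : ℕ → FeatureMap m d) (τ : ℕ → Finset (Fin m)) (t : ℕ) : ℝ :=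
  ∑ i ∈ τ t, (φ t i).ofLp ⬝ᵥ (gram γ φ τ t)⁻¹ *ᵥ (φ t i).ofLp

theorem batchWidth_nonneg {γ : ℝ} (hγ : 0 < γ) (φ : ℕ → FeatureMap m d) (τ : ℕ → Finset (Fin m))
    (t : ℕ) : 0 ≤ batchWidth γ φ τ t :=
  Finset.sum_nonneg fun _ _ => (gram_posDef hγ φ τ t).inv_quadForm_nonneg _

theorem det_gram_mul_le {γ : ℝ} (hγ : 0 < γ) (φ : ℕ → FeatureMap m d) (τ : ℕ → Finset (Fin m))
    (t : ℕ) : (gram γ φ τ t).det * (1 + batchWidth γ φ τ t) ≤ (gram γ φ τ (t + 1)).det := by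
  have h := (gram_posDef hγ φ τ t).det_mul_one_add_trace_le (posSemidef_sum_vecMulVec (τ t) (φ t))
  rwa [Matrix.mul_sum, Matrix.trace_sum,
    Finset.sum_congr rfl fun i _ => Matrix.trace_mul_vecMulVec_self _ _] at h

/-- The elliptical potential lemma for batches. -/
theorem sum_log_one_add_batchWidth_le {γ : ℝ} (hγ : 0 < γ) (φ : ℕ → FeatureMap m d)
    (τ : ℕ → Finset (Fin m)) (t : ℕ) :
    ∑ s ∈ Finset.range t, Real.log (1 + batchWidth γ φ τ s) ≤
      Real.log ((gram γ φ τ t).det / γ ^ d) := by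
  induction t with
  | zero => simp [det_gram_zero, (pow_pos hγ d).ne']
  | succ t ih =>
    have h0 := (gram_posDef hγ φ τ t).det_pos
    have hV := batchWidth_nonneg hγ φ τ t
    have hpd := pow_pos hγ d
    rw [Finset.sum_range_succ]
    refine (add_le_add_left ih _).trans ?_
    rw [← Real.log_mul (div_pos h0 hpd).ne' (by positivity)]
    refine Real.log_le_log (by positivity) ?_
    rw [div_mul_eq_mul_div]
    exact div_le_div_of_nonneg_right (det_gram_mul_le hγ φ τ t) hpd.le

/-- The accumulated noise `∑_{s<t} ∑_{i ∈ τ_s} (X_{s,i} - ⟨θ, φ_s(i)⟩) φ_s(i)`. -/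
def noiseVec (γ : ℝ) (θ : Fin d → ℝ) (φ : ℕ → FeatureMap m d) (X : ℕ → Fin m → Bool)
    (τ : ℕ → Finset (Fin m)) (t : ℕ) : Fin d → ℝ :=
  bVec φ X τ t - gram γ φ τ t *ᵥ θ + γ • θ

theorem noiseVec_zero (γ : ℝ) (θ : Fin d → ℝ) (φ : ℕ → FeatureMap m d) (X : ℕ → Fin m → Bool)
    (τ : ℕ → Finset (Fin m)) : noiseVec γ θ φ X τ 0 = 0 := by
  simp [noiseVec, bVec, gram, Matrix.smul_mulVec]

theorem dotProduct_noiseVec_succ (γ : ℝ) (θ : EuclideanSpace ℝ (Fin d)) (φ : ℕ → FeatureMap m d)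
    (X : ℕ → Fin m → Bool) (τ : ℕ → Finset (Fin m)) (t : ℕ) (v : Fin d → ℝ) :
    v ⬝ᵥ noiseVec γ θ.ofLp φ X τ (t + 1) = v ⬝ᵥ noiseVec γ θ.ofLp φ X τ t +
      ∑ i ∈ τ t, (v ⬝ᵥ (φ t i).ofLp) * ((if X t i then 1 else 0) - meanVec θ (φ t) i) := by
  have h : noiseVec γ θ.ofLp φ X τ (t + 1) = noiseVec γ θ.ofLp φ X τ t +
      ∑ i ∈ τ t, ((if X t i then 1 else 0) - meanVec θ (φ t) i) • (φ t i).ofLp := by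
    simp only [noiseVec, bVec, gram, Matrix.add_mulVec, Matrix.sum_mulVec, sub_smul,
      Finset.sum_sub_distrib, Matrix.vecMulVec_mulVec, op_smul_eq_smul, meanVec_eq_dotProduct]
    abel
  rw [h, dotProduct_add, dotProduct_sum]
  congr 1
  exact Finset.sum_congr rfl fun i _ => by rw [dotProduct_smul, smul_eq_mul, mul_comm]

/-- The logarithm of the exponential supermartingale in direction `v`. -/
def logExpMartingale (γ : ℝ) (θ : Fin d → ℝ) (φ : ℕ → FeatureMap m d) (X : ℕ → Fin m → Bool)
    (τ : ℕ → Finset (Fin m)) (t : ℕ) (v : Fin d → ℝ) : ℝ :=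
  v ⬝ᵥ noiseVec γ θ φ X τ t - (v ⬝ᵥ gram γ φ τ t *ᵥ v) / 2 + γ * (v ⬝ᵥ v) / 2

theorem logExpMartingale_zero (γ : ℝ) (θ : Fin d → ℝ) (φ : ℕ → FeatureMap m d)
    (X : ℕ → Fin m → Bool) (τ : ℕ → Finset (Fin m)) (v : Fin d → ℝ) :
    logExpMartingale γ θ φ X τ 0 v = 0 := by
  simp [logExpMartingale, noiseVec_zero, gram, Matrix.smul_mulVec]

/-- The term `γ (v·v) / 2` in the definition cancels the regularizer inside the Gram matrix, so the
increment involves only the arms triggered in round `t`, in the form treated by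
`C2MABT.TriggeringByObserved.sum_exp_le_one`. -/
theorem logExpMartingale_succ (γ : ℝ) (θ : EuclideanSpace ℝ (Fin d)) (φ : ℕ → FeatureMap m d)
    (X : ℕ → Fin m → Bool) (τ : ℕ → Finset (Fin m)) (t : ℕ) (v : Fin d → ℝ) :
    logExpMartingale γ θ.ofLp φ X τ (t + 1) v = logExpMartingale γ θ.ofLp φ X τ t v +
      ∑ i ∈ τ t, ((v ⬝ᵥ (φ t i).ofLp) * ((if X t i then 1 else 0) - meanVec θ (φ t) i) -
        (v ⬝ᵥ (φ t i).ofLp) ^ 2 / 2) := by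
  simp only [logExpMartingale, dotProduct_noiseVec_succ, dotProduct_gram_succ_mulVec,
    Finset.sum_sub_distrib, ← Finset.sum_div]
  ring

/-- The width `‖φ_t(i)‖_{G_t⁻¹}`. -/
def armWidth (γ : ℝ) (φ : ℕ → FeatureMap m d) (τ : ℕ → Finset (Fin m)) (t : ℕ) (i : Fin m) : ℝ :=
  √((φ t i).ofLp ⬝ᵥ (gram γ φ τ t)⁻¹ *ᵥ (φ t i).ofLp)

theorem armWidth_nonneg (γ : ℝ) (φ : ℕ → FeatureMap m d) (τ : ℕ → Finset (Fin m)) (t : ℕ)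
    (i : Fin m) : 0 ≤ armWidth γ φ τ t i := Real.sqrt_nonneg _

/-- With `s` the noise vector, `θ̂ - θ = G⁻¹ s - γ G⁻¹ θ`, and both terms are bounded by
Cauchy–Schwarz for `G⁻¹`. The regularization bias contributes `γ √(1/γ) = √γ`, the second term of
the confidence radius. -/
theorem abs_dotProduct_thetaHat_sub_le {γ : ℝ} (hγ : 0 < γ) {θ : EuclideanSpace ℝ (Fin d)}
    (hθ : ‖θ‖ ≤ 1) (φ : ℕ → FeatureMap m d) (X : ℕ → Fin m → Bool) (τ : ℕ → Finset (Fin m))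
    (t : ℕ) {R : ℝ} (hR : √(noiseVec γ θ.ofLp φ X τ t ⬝ᵥ
      (gram γ φ τ t)⁻¹ *ᵥ noiseVec γ θ.ofLp φ X τ t) ≤ R) (i : Fin m) :
    |(φ t i).ofLp ⬝ᵥ thetaHat γ φ X τ t - meanVec θ (φ t) i| ≤
      (R + √γ) * armWidth γ φ τ t i := by
  have hG := gram_posDef hγ φ τ t
  set G := gram γ φ τ t with hGdef
  set s := noiseVec γ θ.ofLp φ X τ t with hs
  have e1 : thetaHat γ φ X τ t = G⁻¹ *ᵥ s + θ.ofLp - γ • (G⁻¹ *ᵥ θ.ofLp) := by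
    have : bVec φ X τ t = s + G *ᵥ θ.ofLp - γ • θ.ofLp := by
      rw [hs, noiseVec]; abel
    rw [thetaHat, this, Matrix.mulVec_sub, Matrix.mulVec_add, hG.inv_mulVec_mulVec,
      Matrix.mulVec_smul]
  have e2 : (φ t i).ofLp ⬝ᵥ thetaHat γ φ X τ t - meanVec θ (φ t) i =
      (φ t i).ofLp ⬝ᵥ G⁻¹ *ᵥ s - γ * ((φ t i).ofLp ⬝ᵥ G⁻¹ *ᵥ θ.ofLp) := by
    rw [e1, dotProduct_sub, dotProduct_add, meanVec_eq_dotProduct, dotProduct_smul, smul_eq_mul]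
    ring
  have h1 := hG.inv.abs_dotProduct_mulVec_le (φ t i).ofLp s
  have h2 := hG.inv.abs_dotProduct_mulVec_le (φ t i).ofLp θ.ofLp
  have h3 : γ * √(θ.ofLp ⬝ᵥ G⁻¹ *ᵥ θ.ofLp) ≤ √γ := by
    have := Real.sqrt_le_sqrt (gram_inv_quadForm_le hγ φ τ t hθ)
    calc γ * √(θ.ofLp ⬝ᵥ G⁻¹ *ᵥ θ.ofLp) ≤ γ * √(1 / γ) := mul_le_mul_of_nonneg_left this hγ.le
      _ = √γ := by
        rw [one_div, Real.sqrt_inv]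
        nth_rewrite 1 [← Real.mul_self_sqrt hγ.le]
        rw [mul_assoc, mul_inv_cancel₀ (Real.sqrt_pos.mpr hγ).ne', mul_one]
  have h4 : 0 ≤ √((φ t i).ofLp ⬝ᵥ G⁻¹ *ᵥ (φ t i).ofLp) := Real.sqrt_nonneg _
  rw [e2, armWidth, ← hGdef]
  refine (abs_sub _ _).trans ?_
  rw [abs_mul, abs_of_pos hγ]
  calc _ ≤ √((φ t i).ofLp ⬝ᵥ G⁻¹ *ᵥ (φ t i).ofLp) * R + γ *
        (√((φ t i).ofLp ⬝ᵥ G⁻¹ *ᵥ (φ t i).ofLp) * √(θ.ofLp ⬝ᵥ G⁻¹ *ᵥ θ.ofLp)) :=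
        add_le_add (h1.trans (mul_le_mul_of_nonneg_left hR h4))
          (mul_le_mul_of_nonneg_left h2 hγ.le)
    _ ≤ _ := by nlinarith [mul_le_mul_of_nonneg_left h3 h4]

theorem ucb_mem_unitCube (γ ρ : ℝ) (φ : ℕ → FeatureMap m d) (X : ℕ → Fin m → Bool)
    (τ : ℕ → Finset (Fin m)) (t : ℕ) : ucb γ ρ φ X τ t ∈ unitCube m :=
  fun _ => ⟨le_max_left _ _, max_le zero_le_one (min_le_left _ _)⟩

theorem meanVec_le_ucb {γ ρ : ℝ} {θ : EuclideanSpace ℝ (Fin d)} {φ : ℕ → FeatureMap m d}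
    {X : ℕ → Fin m → Bool} {τ : ℕ → Finset (Fin m)} {t : ℕ} {i : Fin m}
    (hθ : meanVec θ (φ t) i ∈ Set.Icc (0 : ℝ) 1)
    (h : |(φ t i).ofLp ⬝ᵥ thetaHat γ φ X τ t - meanVec θ (φ t) i| ≤ ρ * armWidth γ φ τ t i) :
    meanVec θ (φ t) i ≤ ucb γ ρ φ X τ t i := by
  refine le_max_of_le_right (le_min hθ.2 ?_)
  have := (abs_le.mp h).1
  rw [armWidth] at this
  linarith

theorem abs_meanVec_sub_ucb_le {γ ρ : ℝ} {θ : EuclideanSpace ℝ (Fin d)} {φ : ℕ → FeatureMap m d}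
    {X : ℕ → Fin m → Bool} {τ : ℕ → Finset (Fin m)} {t : ℕ} {i : Fin m}
    (hθ : meanVec θ (φ t) i ∈ Set.Icc (0 : ℝ) 1)
    (h : |(φ t i).ofLp ⬝ᵥ thetaHat γ φ X τ t - meanVec θ (φ t) i| ≤ ρ * armWidth γ φ τ t i) :
    |meanVec θ (φ t) i - ucb γ ρ φ X τ t i| ≤ min 1 (2 * ρ * armWidth γ φ τ t i) := by
  have h1 := meanVec_le_ucb hθ h
  have h2 := ucb_mem_unitCube γ ρ φ X τ t i
  have h0 := (abs_nonneg _).trans h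
  rw [abs_sub_comm, abs_of_nonneg (sub_nonneg.mpr h1)]
  refine le_min (by linarith [hθ.1, h2.2]) ?_
  have h3 := (abs_le.mp h).2
  rw [sub_le_iff_le_add, ucb]
  refine max_le (by linarith [hθ.1]) ((min_le_right _ _).trans ?_)
  rw [armWidth] at *
  linarith

/-- A dichotomy on the batch width `V`. If `V ≤ 1`, Cauchy–Schwarz and `V ≤ 2 log (1 + V)` give the
square root term. If `V > 1`, the trivial bound `K` is charged to `log (1 + V) / log 2 ≥ 1`. -/
theorem sum_min_one_armWidth_le {γ ρ : ℝ} (hγ : 0 < γ) (hρ : 0 ≤ ρ) {φ : ℕ → FeatureMap m d}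
    {τ : ℕ → Finset (Fin m)} {K t : ℕ} (hφ : ∀ i, ‖φ t i‖ ≤ 1) (hτ : (τ t).card ≤ K) :
    ∑ i ∈ τ t, min 1 (2 * ρ * armWidth γ φ τ t i) ≤
      (if (K : ℝ) ≤ γ then (0 : ℝ) else K) * (Real.log (1 + batchWidth γ φ τ t) / Real.log 2) +
        2 * ρ * √(2 * K * Real.log (1 + batchWidth γ φ τ t)) := by
  have hV0 := batchWidth_nonneg hγ φ τ t
  have hG := gram_posDef hγ φ τ t
  set V := batchWidth γ φ τ t with hV
  have hl0 : 0 ≤ Real.log (1 + V) := Real.log_nonneg (by linarith)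
  have hl2 : 0 < Real.log 2 := Real.log_pos one_lt_two
  have hK : ((τ t).card : ℝ) ≤ K := by exact_mod_cast hτ
  rcases le_or_gt V 1 with h1 | h1
  · have hlog : V ≤ 2 * Real.log (1 + V) := by
      -- `log (1 + V) ≥ V / (1 + V) ≥ V / 2`, since `V ≤ 1`.
      have := Real.one_sub_inv_le_log_of_pos (show 0 < 1 + V by linarith)
      have h2 : V / 2 ≤ 1 - (1 + V)⁻¹ := by
        rw [inv_eq_one_div, le_sub_iff_add_le, ← le_sub_iff_add_le', div_le_iff₀ (by linarith)]
        nlinarith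
      linarith
    have hcs : ∑ i ∈ τ t, armWidth γ φ τ t i ≤ √(2 * K * Real.log (1 + V)) := by
      refine Real.le_sqrt_of_sq_le ?_
      calc (∑ i ∈ τ t, armWidth γ φ τ t i) ^ 2
          ≤ (τ t).card * ∑ i ∈ τ t, armWidth γ φ τ t i ^ 2 := sq_sum_le_card_mul_sum_sq
        _ = (τ t).card * V := by
            rw [hV, batchWidth]
            congr 1
            exact Finset.sum_congr rfl fun i _ => Real.sq_sqrt (hG.inv_quadForm_nonneg _)
        _ ≤ K * (2 * Real.log (1 + V)) := mul_le_mul hK hlog hV0 K.cast_nonneg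
        _ = _ := by ring
    calc ∑ i ∈ τ t, min 1 (2 * ρ * armWidth γ φ τ t i)
        ≤ ∑ i ∈ τ t, 2 * ρ * armWidth γ φ τ t i := Finset.sum_le_sum fun i _ => min_le_right _ _
      _ = 2 * ρ * ∑ i ∈ τ t, armWidth γ φ τ t i := by rw [Finset.mul_sum]
      _ ≤ 2 * ρ * √(2 * K * Real.log (1 + V)) := mul_le_mul_of_nonneg_left hcs (by positivity)
      _ ≤ _ := by
        refine le_add_of_nonneg_left (mul_nonneg ?_ (by positivity))
        split_ifs <;> positivity
  -- Every squared width is at most `1/γ`, so `K ≤ γ` would force `V ≤ 1`.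
  · have hKγ : ¬ (K : ℝ) ≤ γ := by
      intro h
      have : V ≤ (τ t).card * (1 / γ) := by
        rw [hV, batchWidth, ← nsmul_eq_mul, ← Finset.sum_const]
        exact Finset.sum_le_sum fun i _ => gram_inv_quadForm_le hγ φ τ t (hφ i)
      have h2 : (τ t).card * (1 / γ) ≤ 1 := by
        rw [mul_one_div, div_le_one hγ]; linarith
      linarith
    have hlog : 1 ≤ Real.log (1 + V) / Real.log 2 := by
      rw [one_le_div hl2]
      exact Real.log_le_log two_pos (by linarith)
    rw [if_neg hKγ]
    calc ∑ i ∈ τ t, min 1 (2 * ρ * armWidth γ φ τ t i)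
        ≤ ∑ i ∈ τ t, (1 : ℝ) := Finset.sum_le_sum fun i _ => min_le_left _ _
      _ ≤ K := by simpa using hK
      _ ≤ K * (Real.log (1 + V) / Real.log 2) := le_mul_of_one_le_right K.cast_nonneg hlog
      _ ≤ _ := le_add_of_nonneg_right (by positivity)

theorem Finset.sum_sqrt_le {ι : Type*} (s : Finset ι) (f : ι → ℝ) (hf : ∀ i ∈ s, 0 ≤ f i) :
    ∑ i ∈ s, √(f i) ≤ √(s.card * ∑ i ∈ s, f i) := by
  refine Real.le_sqrt_of_sq_le ((sq_sum_le_card_mul_sum_sq).trans (le_of_eq ?_))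
  congr 1
  exact Finset.sum_congr rfl fun i hi => Real.sq_sqrt (hf i hi)

theorem sum_sum_min_one_armWidth_le {γ ρ : ℝ} (hγ : 0 < γ) (hρ : 0 ≤ ρ) {φ : ℕ → FeatureMap m d}
    {τ : ℕ → Finset (Fin m)} {K T : ℕ} (hφ : ∀ t < T, ∀ i, ‖φ t i‖ ≤ 1)
    (hτ : ∀ t < T, (τ t).card ≤ K) {Λ : ℝ} (hΛ : Real.log ((γ + K * T / d) ^ d / γ ^ d) ≤ Λ) :
    ∑ t ∈ Finset.range T, ∑ i ∈ τ t, min 1 (2 * ρ * armWidth γ φ τ t i) ≤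
      (if (K : ℝ) ≤ γ then (0 : ℝ) else K) * (Λ / Real.log 2) + 2 * ρ * √(2 * (K * T) * Λ) := by
  have hsum : ∑ t ∈ Finset.range T, Real.log (1 + batchWidth γ φ τ t) ≤ Λ := by
    refine (sum_log_one_add_batchWidth_le hγ φ τ T).trans (le_trans ?_ hΛ)
    refine Real.log_le_log (div_pos (gram_posDef hγ φ τ T).det_pos (pow_pos hγ d)) ?_
    exact div_le_div_of_nonneg_right (det_gram_le hγ le_rfl hφ hτ) (pow_pos hγ d).le
  have hl0 : ∀ t, 0 ≤ Real.log (1 + batchWidth γ φ τ t) := fun t =>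
    Real.log_nonneg (by linarith [batchWidth_nonneg hγ φ τ t])
  have hc : (0 : ℝ) ≤ if (K : ℝ) ≤ γ then (0 : ℝ) else K := by split_ifs <;> positivity
  calc _ ≤ ∑ t ∈ Finset.range T,
        ((if (K : ℝ) ≤ γ then (0 : ℝ) else K) * (Real.log (1 + batchWidth γ φ τ t) / Real.log 2) +
        2 * ρ * √(2 * K * Real.log (1 + batchWidth γ φ τ t))) :=
        Finset.sum_le_sum fun t ht =>
          have ht := Finset.mem_range.mp ht
          sum_min_one_armWidth_le hγ hρ (hφ t ht) (hτ t ht)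
    _ ≤ _ := by
      rw [Finset.sum_add_distrib, ← Finset.mul_sum, ← Finset.mul_sum, ← Finset.sum_div]
      have hl2 : 0 < Real.log 2 := Real.log_pos one_lt_two
      refine add_le_add (mul_le_mul_of_nonneg_left (by gcongr) hc)
        (mul_le_mul_of_nonneg_left ?_ (by positivity))
      refine (Finset.sum_sqrt_le _ _ fun t _ => mul_nonneg (by positivity) (hl0 t)).trans
        (Real.sqrt_le_sqrt ?_)
      rw [← Finset.mul_sum, Finset.card_range]
      calc (T : ℝ) * (2 * K * ∑ t ∈ Finset.range T, Real.log (1 + batchWidth γ φ τ t))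
          = 2 * (K * T) * ∑ t ∈ Finset.range T, Real.log (1 + batchWidth γ φ τ t) := by ring
        _ ≤ _ := mul_le_mul_of_nonneg_left hsum (by positivity)

end Deterministic

/-! ### Measurability of the algorithm's quantities, for an arbitrary σ-algebra on the sample space.
-/

section Measurability

theorem Matrix.measurable_det_comp {E n : Type*} [MeasurableSpace E] [Fintype n] [DecidableEq n]
    {G : E → Matrix n n ℝ} (hG : ∀ i j, Measurable fun ω => G ω i j) :
    Measurable fun ω => (G ω).det := by
  have hc : Continuous fun A : n → n → ℝ => (Matrix.of A).det :=
    Continuous.matrix_det (A := fun A : n → n → ℝ => Matrix.of A) continuous_id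
  exact hc.measurable.comp (measurable_pi_iff.mpr fun i => measurable_pi_iff.mpr fun j => hG i j)

theorem Matrix.measurable_inv_apply {E n : Type*} [MeasurableSpace E] [Fintype n] [DecidableEq n]
    {G : E → Matrix n n ℝ} (hG : ∀ i j, Measurable fun ω => G ω i j) (i j : n) :
    Measurable fun ω => (G ω)⁻¹ i j := by
  have hc : Continuous fun A : n → n → ℝ => (Matrix.of A).adjugate i j :=
    (Continuous.matrix_adjugate (A := fun A : n → n → ℝ => Matrix.of A) continuous_id).matrix_elem
      i j
  have hadj : Measurable fun ω => (G ω).adjugate i j :=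
    hc.measurable.comp (measurable_pi_iff.mpr fun i => measurable_pi_iff.mpr fun j => hG i j)
  simp only [Matrix.inv_def, Matrix.smul_apply, smul_eq_mul, Ring.inverse_eq_inv']
  exact (Matrix.measurable_det_comp hG).inv.mul hadj

theorem Measurable.dotProduct {E n : Type*} [MeasurableSpace E] [Fintype n] {x y : E → n → ℝ}
    (hx : Measurable x) (hy : Measurable y) : Measurable fun ω => x ω ⬝ᵥ y ω :=
  Finset.measurable_sum _ fun i _ =>
    ((measurable_pi_apply i).comp hx).mul ((measurable_pi_apply i).comp hy)

theorem Measurable.matrix_mulVec {E n : Type*} [MeasurableSpace E] [Fintype n]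
    {G : E → Matrix n n ℝ} (hG : ∀ i j, Measurable fun ω => G ω i j) {x : E → n → ℝ}
    (hx : Measurable x) : Measurable fun ω => G ω *ᵥ x ω :=
  measurable_pi_iff.mpr fun i =>
    Measurable.dotProduct (measurable_pi_iff.mpr fun j => hG i j) hx

variable {m d : ℕ} {E : Type*} [MeasurableSpace E] {φ : ℕ → E → FeatureMap m d}
  {X : ℕ → E → Fin m → Bool} {τ : ℕ → E → Finset (Fin m)} {t : ℕ}

theorem FeatureMap.measurable_ofLp {ψ : E → FeatureMap m d} (hψ : Measurable ψ) (i : Fin m) :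
    Measurable fun ω => (ψ ω i).ofLp := by
  fun_prop

theorem measurable_gram_apply (γ : ℝ) (hφ : ∀ s < t, Measurable (φ s))
    (hτ : ∀ s < t, Measurable (τ s)) (i j : Fin d) :
    Measurable fun ω => gram γ (fun s => φ s ω) (fun s => τ s ω) t i j := by
  induction t with
  | zero => exact measurable_const
  | succ t ih =>
    simp only [gram, Matrix.add_apply, Matrix.sum_apply, Matrix.vecMulVec_apply]
    refine (ih (fun s hs => hφ s (hs.trans t.lt_succ_self))
      (fun s hs => hτ s (hs.trans t.lt_succ_self))).add ?_
    have e : (fun ω => ∑ k ∈ τ t ω, (φ t ω k).ofLp i * (φ t ω k).ofLp j) =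
        fun ω => ∑ k, if k ∈ τ t ω then (φ t ω k).ofLp i * (φ t ω k).ofLp j else 0 := by
      funext ω
      rw [Finset.sum_ite_mem, Finset.univ_inter]
    rw [e]
    refine Finset.measurable_sum _ fun k _ => Measurable.ite ?_ ?_ measurable_const
    · exact hτ t t.lt_succ_self (MeasurableSet.of_discrete (s := {A | k ∈ A}))
    · have := FeatureMap.measurable_ofLp (hφ t t.lt_succ_self) k
      exact ((measurable_pi_apply i).comp this).mul ((measurable_pi_apply j).comp this)

/-- Outcomes are assumed measurable only after masking, so that the statement applies to the history
σ-algebra as well as to the ambient one. -/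
theorem measurable_bVec (hφ : ∀ s < t, Measurable (φ s)) (hτ : ∀ s < t, Measurable (τ s))
    (hX : ∀ s < t, Measurable fun ω i => if i ∈ τ s ω then X s ω i else false) :
    Measurable fun ω => bVec (fun s => φ s ω) (fun s => X s ω) (fun s => τ s ω) t := by
  induction t with
  | zero => exact measurable_const
  | succ t ih =>
    simp only [bVec]
    refine (ih (fun s hs => hφ s (hs.trans t.lt_succ_self))
      (fun s hs => hτ s (hs.trans t.lt_succ_self))
      (fun s hs => hX s (hs.trans t.lt_succ_self))).add ?_
    have e : (fun ω => ∑ k ∈ τ t ω, (if X t ω k then (1 : ℝ) else 0) • (φ t ω k).ofLp) =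
        fun ω => ∑ k, (if (if k ∈ τ t ω then X t ω k else false) then (1 : ℝ) else 0) •
          (φ t ω k).ofLp := by
      funext ω
      rw [← Finset.univ_inter (τ t ω), ← Finset.sum_ite_mem]
      refine Finset.sum_congr rfl fun k _ => ?_
      by_cases hk : k ∈ τ t ω <;> simp [hk]
    rw [e]
    refine Finset.measurable_sum _ fun k _ => Measurable.fun_smul ?_
      (FeatureMap.measurable_ofLp (hφ t t.lt_succ_self) k)
    have h1 : Measurable fun ω => if k ∈ τ t ω then X t ω k else false :=
      (measurable_pi_apply k).comp (hX t t.lt_succ_self)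
    exact (measurable_of_countable fun b : Bool => if b then (1 : ℝ) else 0).comp h1

theorem measurable_armWidth_sq (γ : ℝ) (hφ : ∀ s ≤ t, Measurable (φ s))
    (hτ : ∀ s < t, Measurable (τ s)) (i : Fin m) :
    Measurable fun ω => (φ t ω i).ofLp ⬝ᵥ
      (gram γ (fun s => φ s ω) (fun s => τ s ω) t)⁻¹ *ᵥ (φ t ω i).ofLp :=
  have h := FeatureMap.measurable_ofLp (hφ t le_rfl) i
  h.dotProduct (Measurable.matrix_mulVec (Matrix.measurable_inv_apply
    (measurable_gram_apply γ (fun s hs => hφ s hs.le) hτ)) h)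

theorem measurable_armWidth (γ : ℝ) (hφ : ∀ s ≤ t, Measurable (φ s))
    (hτ : ∀ s < t, Measurable (τ s)) (i : Fin m) :
    Measurable fun ω => armWidth γ (fun s => φ s ω) (fun s => τ s ω) t i :=
  (measurable_armWidth_sq γ hφ hτ i).sqrt

theorem measurable_ucb (γ ρ : ℝ) (hφ : ∀ s ≤ t, Measurable (φ s))
    (hτ : ∀ s < t, Measurable (τ s))
    (hX : ∀ s < t, Measurable fun ω i => if i ∈ τ s ω then X s ω i else false) :
    Measurable fun ω => ucb γ ρ (fun s => φ s ω) (fun s => X s ω) (fun s => τ s ω) t := by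
  refine measurable_pi_iff.mpr fun i => measurable_const.max (measurable_const.min ?_)
  refine Measurable.add ?_ (measurable_const.mul (measurable_armWidth_sq γ hφ hτ i).sqrt)
  refine (FeatureMap.measurable_ofLp (hφ t le_rfl) i).dotProduct ?_
  exact Measurable.matrix_mulVec (Matrix.measurable_inv_apply
    (measurable_gram_apply γ (fun s hs => hφ s hs.le) hτ))
    (measurable_bVec (fun s hs => hφ s hs.le) hτ hX)

theorem measurable_noiseVec (γ : ℝ) (θ : Fin d → ℝ) (hφ : ∀ s < t, Measurable (φ s))
    (hτ : ∀ s < t, Measurable (τ s))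
    (hX : ∀ s < t, Measurable fun ω i => if i ∈ τ s ω then X s ω i else false) :
    Measurable fun ω => noiseVec γ θ (fun s => φ s ω) (fun s => X s ω) (fun s => τ s ω) t :=
  ((measurable_bVec hφ hτ hX).sub
    (Measurable.matrix_mulVec (measurable_gram_apply γ hφ hτ) measurable_const)).add_const _

theorem measurable_noise_quadForm (γ : ℝ) (θ : Fin d → ℝ) (hφ : ∀ s < t, Measurable (φ s))
    (hτ : ∀ s < t, Measurable (τ s))
    (hX : ∀ s < t, Measurable fun ω i => if i ∈ τ s ω then X s ω i else false) :
    Measurable fun ω => noiseVec γ θ (fun s => φ s ω) (fun s => X s ω) (fun s => τ s ω) t ⬝ᵥ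
      (gram γ (fun s => φ s ω) (fun s => τ s ω) t)⁻¹ *ᵥ
        noiseVec γ θ (fun s => φ s ω) (fun s => X s ω) (fun s => τ s ω) t :=
  have h := measurable_noiseVec γ θ hφ hτ hX
  h.dotProduct (Measurable.matrix_mulVec (Matrix.measurable_inv_apply
    (measurable_gram_apply γ hφ hτ)) h)

theorem measurable_logExpMartingale (γ : ℝ) (θ : Fin d → ℝ) (hφ : ∀ s < t, Measurable (φ s))
    (hτ : ∀ s < t, Measurable (τ s))
    (hX : ∀ s < t, Measurable fun ω i => if i ∈ τ s ω then X s ω i else false) :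
    Measurable fun p : E × (Fin d → ℝ) => logExpMartingale γ θ (fun s => φ s p.1)
      (fun s => X s p.1) (fun s => τ s p.1) t p.2 := by
  refine ((measurable_snd.dotProduct ((measurable_noiseVec γ θ hφ hτ hX).comp
    measurable_fst)).sub (Measurable.div_const ?_ 2)).add
    (((measurable_snd.dotProduct measurable_snd).const_mul γ).div_const 2)
  exact measurable_snd.dotProduct (Measurable.matrix_mulVec
    (fun i j => (measurable_gram_apply γ hφ hτ i j).comp measurable_fst) measurable_snd)

theorem measurable_meanVec (θ : EuclideanSpace ℝ (Fin d)) {ψ : E → FeatureMap m d}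
    (hψ : Measurable ψ) : Measurable fun ω => meanVec θ (ψ ω) :=
  measurable_pi_iff.mpr fun i => by
    simp only [meanVec_eq_dotProduct]
    exact (FeatureMap.measurable_ofLp hψ i).dotProduct measurable_const

theorem measurable_bernoulliWeight (x : Fin m → Bool) :
    Measurable fun μ : Fin m → ℝ => bernoulliWeight μ x := by
  refine Finset.measurable_prod _ fun i _ => ?_
  split_ifs
  · exact measurable_pi_apply i
  · exact measurable_const.sub (measurable_pi_apply i)

variable {𝒮 : Type*} [MeasurableSpace 𝒮] (I : C2MABT m d 𝒮)

theorem C2MABT.measurable_weight (x : Fin m → Bool) (A : Finset (Fin m)) :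
    Measurable fun p : (Fin m → ℝ) × 𝒮 =>
      bernoulliWeight p.1 x * (I.Dtrig p.2 x A).toReal :=
  ((measurable_bernoulliWeight x).comp measurable_fst).mul
    (((I.measurable_Dtrig x A).comp measurable_snd).ennreal_toReal)

theorem C2MABT.measurable_r : Measurable fun p : (Fin m → ℝ) × 𝒮 => I.r p.2 p.1 :=
  Finset.measurable_sum _ fun x _ => Finset.measurable_sum _ fun A _ =>
    (I.measurable_weight x A).mul ((I.measurable_R x A).comp measurable_snd)

theorem C2MABT.measurable_r_comp {u : E → Fin m → ℝ} {a : E → 𝒮} (hu : Measurable u)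
    (ha : Measurable a) : Measurable fun ω => I.r (a ω) (u ω) :=
  Measurable.comp (g := fun p : (Fin m → ℝ) × 𝒮 => I.r p.2 p.1) (f := fun ω => (u ω, a ω))
    I.measurable_r (hu.prodMk ha)

theorem C2MABT.measurable_trigProb (i : Fin m) :
    Measurable fun p : (Fin m → ℝ) × 𝒮 => I.trigProb p.1 p.2 i :=
  Finset.measurable_sum _ fun x _ => Finset.measurable_sum _ fun A _ => by
    split_ifs
    · exact I.measurable_weight x A
    · exact measurable_const

theorem C2MABT.measurable_trigProb_comp {u : E → Fin m → ℝ} {a : E → 𝒮} (hu : Measurable u)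
    (ha : Measurable a) (i : Fin m) : Measurable fun ω => I.trigProb (u ω) (a ω) i :=
  Measurable.comp (g := fun p : (Fin m → ℝ) × 𝒮 => I.trigProb p.1 p.2 i)
    (f := fun ω => (u ω, a ω)) (I.measurable_trigProb i) (hu.prodMk ha)

end Measurability

/-! ### Triggering probabilities, the sign of the smoothness coefficient, and regularity of the
optimal reward. -/

section InstanceBounds

variable {m d : ℕ} {𝒮 : Type*} [MeasurableSpace 𝒮] {I : C2MABT m d 𝒮} {μ : Fin m → ℝ}

theorem C2MABT.weight_nonneg (hμ : μ ∈ unitCube m) (S : 𝒮) (x : Fin m → Bool)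
    (A : Finset (Fin m)) : 0 ≤ bernoulliWeight μ x * (I.Dtrig S x A).toReal :=
  mul_nonneg (bernoulliWeight_nonneg hμ x) ENNReal.toReal_nonneg

variable (I) in
theorem C2MABT.sum_weight (μ : Fin m → ℝ) (S : 𝒮) :
    ∑ x : Fin m → Bool, ∑ A, bernoulliWeight μ x * (I.Dtrig S x A).toReal = 1 := by
  simp only [← Finset.mul_sum, I.sum_Dtrig, mul_one, sum_bernoulliWeight]

theorem C2MABT.r_nonneg (hμ : μ ∈ unitCube m) (S : 𝒮) : 0 ≤ I.r S μ :=
  Finset.sum_nonneg fun x _ => Finset.sum_nonneg fun A _ =>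
    mul_nonneg (weight_nonneg hμ S x A) (I.R_nonneg S x A)

theorem C2MABT.trigProb_nonneg (hμ : μ ∈ unitCube m) (S : 𝒮) (i : Fin m) :
    0 ≤ I.trigProb μ S i :=
  Finset.sum_nonneg fun x _ => Finset.sum_nonneg fun A _ => by
    split_ifs
    · exact weight_nonneg hμ S x A
    · exact le_rfl

theorem C2MABT.trigProb_le_one (hμ : μ ∈ unitCube m) (S : 𝒮) (i : Fin m) :
    I.trigProb μ S i ≤ 1 := by
  rw [← I.sum_weight μ S]
  refine Finset.sum_le_sum fun x _ => Finset.sum_le_sum fun A _ => ?_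
  split_ifs
  · exact le_rfl
  · exact weight_nonneg hμ S x A

theorem C2MABT.weight_le_trigProb (hμ : μ ∈ unitCube m) (S : 𝒮) (x : Fin m → Bool)
    {A : Finset (Fin m)} {i : Fin m} (hi : i ∈ A) :
    bernoulliWeight μ x * (I.Dtrig S x A).toReal ≤ I.trigProb μ S i := by
  have h0 : ∀ (y : Fin m → Bool) (B : Finset (Fin m)),
      0 ≤ if i ∈ B then bernoulliWeight μ y * (I.Dtrig S y B).toReal else 0 := by
    intro y B
    split_ifs
    · exact weight_nonneg hμ S y B
    · exact le_rfl
  calc bernoulliWeight μ x * (I.Dtrig S x A).toReal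
      = if i ∈ A then bernoulliWeight μ x * (I.Dtrig S x A).toReal else 0 := by rw [if_pos hi]
    _ ≤ ∑ B, if i ∈ B then bernoulliWeight μ x * (I.Dtrig S x B).toReal else 0 :=
        Finset.single_le_sum (f := fun B => if i ∈ B then
          bernoulliWeight μ x * (I.Dtrig S x B).toReal else 0) (fun B _ => h0 x B)
          (Finset.mem_univ A)
    _ ≤ I.trigProb μ S i :=
        Finset.single_le_sum (f := fun y => ∑ B, if i ∈ B then
          bernoulliWeight μ y * (I.Dtrig S y B).toReal else 0)
          (fun y _ => Finset.sum_nonneg fun B _ => h0 y B) (Finset.mem_univ x)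

variable (I) in
theorem C2MABT.ncard_canTrigger_le (S : 𝒮) : (I.canTrigger S).ncard ≤ I.batchSize := by
  refine le_ciSup (f := fun S => (I.canTrigger S).ncard) ⟨m, ?_⟩ S
  rintro _ ⟨S, rfl⟩
  simpa using Set.ncard_le_ncard (Set.subset_univ (I.canTrigger S)) Set.finite_univ

theorem C2MABT.mem_unitCube_of_mem_meanVectors (hμ : μ ∈ I.meanVectors) : μ ∈ unitCube m := by
  obtain ⟨θ, hθ, φ, hφ, rfl⟩ := hμ
  exact I.mean_mem θ hθ φ hφ

theorem C2MABT.card_le_batchSize (hμ : μ ∈ I.meanVectors) (S : 𝒮) {A : Finset (Fin m)}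
    (hA : ∀ i ∈ A, 0 < I.trigProb μ S i) : A.card ≤ I.batchSize := by
  refine le_trans ?_ (I.ncard_canTrigger_le S)
  rw [← Set.ncard_coe_finset]
  exact Set.ncard_le_ncard (fun i hi => ⟨μ, hμ, hA i hi⟩) (Set.toFinite _)

theorem C2MABT.sum_trigProb_mul_le (hμ : μ ∈ I.meanVectors) (S : 𝒮) {f : Fin m → ℝ}
    (hf : ∀ i, f i ≤ 1) : ∑ i, I.trigProb μ S i * f i ≤ I.batchSize := by
  have hc := mem_unitCube_of_mem_meanVectors hμ
  classical
  let A : Finset (Fin m) := {i | 0 < I.trigProb μ S i}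
  have hA : A.card ≤ I.batchSize := card_le_batchSize hμ S fun i hi => (Finset.mem_filter.mp hi).2
  calc ∑ i, I.trigProb μ S i * f i ≤ ∑ i, if 0 < I.trigProb μ S i then (1 : ℝ) else 0 := by
        refine Finset.sum_le_sum fun i _ => ?_
        have h0 := trigProb_nonneg (I := I) hc S i
        have h1 := trigProb_le_one (I := I) hc S i
        have h2 := hf i
        split_ifs with h
        · nlinarith
        · rw [le_antisymm (not_lt.mp h) h0, zero_mul]
    _ = A.card := by simp [A]
    _ ≤ I.batchSize := by exact_mod_cast hA

theorem abs_sub_le_one_of_mem_unitCube {μ ν : Fin m → ℝ} (hμ : μ ∈ unitCube m)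
    (hν : ν ∈ unitCube m) (i : Fin m) : |μ i - ν i| ≤ 1 :=
  abs_le.mpr ⟨by linarith [(hμ i).1, (hν i).2], by linarith [(hμ i).2, (hν i).1]⟩

theorem C2MABT.TPMSmooth.nonneg {B : ℝ} (hB : I.TPMSmooth B) (hK : 0 < I.batchSize) : 0 ≤ B := by
  obtain ⟨S, hS⟩ : ∃ S, (I.canTrigger S).Nonempty := by
    by_contra! h
    have h0 : I.batchSize = 0 := by
      rcases isEmpty_or_nonempty 𝒮 with h' | h' <;> simp [C2MABT.batchSize, h]
    omega
  obtain ⟨i, μ, hμ, hp⟩ := hS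
  have hc := mem_unitCube_of_mem_meanVectors hμ
  -- A point of the cube that differs from `μ` in every coordinate. Since some arm has positive
  -- triggering probability, a negative `B` would make the smoothness bound negative.
  let ν : Fin m → ℝ := fun j => if μ j ≤ 1 / 2 then 1 else 0
  have hν : ν ∈ unitCube m := fun j => by
    simp only [ν]; split_ifs <;> simp
  have hne : 0 < |μ i - ν i| := by
    refine abs_pos.mpr (sub_ne_zero.mpr fun h => ?_)
    simp only [ν] at h
    split_ifs at h with h1 <;> linarith
  have hsum : 0 < ∑ j, I.trigProb μ S j * |μ j - ν j| :=
    Finset.sum_pos' (fun j _ => mul_nonneg (trigProb_nonneg hc S j) (abs_nonneg _))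
      ⟨i, Finset.mem_univ i, mul_pos hp hne⟩
  have h := (abs_nonneg _).trans (hB S μ hc ν hν)
  exact nonneg_of_mul_nonneg_left h hsum

theorem C2MABT.FiniteOpt.r_le_opt (hI : I.FiniteOpt) (hμ : μ ∈ unitCube m) (S : 𝒮) :
    I.r S μ ≤ I.opt μ :=
  le_ciSup (f := fun S => I.r S μ) (hI μ hμ) S

theorem C2MABT.opt_nonneg (hμ : μ ∈ unitCube m) : 0 ≤ I.opt μ :=
  Real.iSup_nonneg fun S => r_nonneg hμ S

theorem C2MABT.opt_mono [Nonempty 𝒮] (hI : I.FiniteOpt) (hmono : I.Monotonicity) {ν : Fin m → ℝ}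
    (hμ : μ ∈ unitCube m) (hν : ν ∈ unitCube m) (h : ∀ i, μ i ≤ ν i) : I.opt μ ≤ I.opt ν :=
  ciSup_le fun S => (hmono S μ hμ ν hν h).trans (hI.r_le_opt hν S)

theorem C2MABT.TPMSmooth.opt_le [Nonempty 𝒮] {B c : ℝ} (hB : I.TPMSmooth B) (hB0 : 0 ≤ B)
    (hI : I.FiniteOpt) {ν : Fin m → ℝ} (hμ : μ ∈ unitCube m) (hν : ν ∈ unitCube m)
    (hc : ∀ S, ∑ i, I.trigProb μ S i * |μ i - ν i| ≤ c) :
    I.opt μ ≤ I.opt ν + B * c := by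
  refine ciSup_le fun S => ?_
  have h1 := (abs_le.mp (hB S μ hμ ν hν)).1
  have h2 := mul_le_mul_of_nonneg_left (hc S) hB0
  linarith [hI.r_le_opt hν S]

/-- The action space may be uncountable, so the supremum is not measurable for free. Smoothness
makes it Lipschitz on the cube, and `cubeProj` then extends it to a measurable function on the whole
space. -/
theorem C2MABT.TPMSmooth.continuousOn_opt [Nonempty 𝒮] {B : ℝ} (hB : I.TPMSmooth B) (hB0 : 0 ≤ B)
    (hI : I.FiniteOpt) : ContinuousOn I.opt (unitCube m) := by
  have hlip : ∀ μ ∈ unitCube m, ∀ ν ∈ unitCube m,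
      I.opt μ - I.opt ν ≤ B * m * dist μ ν := by
    intro μ hμ ν hν
    have := hB.opt_le hB0 hI hμ hν (c := m * dist μ ν) fun S => by
      calc ∑ i, I.trigProb μ S i * |μ i - ν i| ≤ ∑ _i : Fin m, dist μ ν := by
            refine Finset.sum_le_sum fun i _ => ?_
            rw [← Real.dist_eq]
            exact (mul_le_of_le_one_left dist_nonneg (trigProb_le_one hμ S i)).trans
              (dist_le_pi_dist μ ν i)
        _ = m * dist μ ν := by simp
    linarith
  refine (LipschitzOnWith.of_dist_le_mul (K := (B * m).toNNReal) fun μ hμ ν hν => ?_).continuousOn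
  rw [Real.coe_toNNReal _ (by positivity), Real.dist_eq, abs_le]
  exact ⟨by have := hlip ν hν μ hμ; rw [dist_comm] at this; linarith, hlip μ hμ ν hν⟩

/-- The projection onto the cube `[0,1]^m`. -/
def cubeProj (m : ℕ) (μ : Fin m → ℝ) : Fin m → ℝ := fun i => max 0 (min 1 (μ i))

theorem cubeProj_mem (μ : Fin m → ℝ) : cubeProj m μ ∈ unitCube m :=
  fun _ => ⟨le_max_left _ _, max_le zero_le_one (min_le_left _ _)⟩

theorem cubeProj_of_mem (hμ : μ ∈ unitCube m) : cubeProj m μ = μ := by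
  funext i
  rw [cubeProj, min_eq_right (hμ i).2, max_eq_right (hμ i).1]

theorem C2MABT.TPMSmooth.measurable_opt_cubeProj [Nonempty 𝒮] {B : ℝ} (hB : I.TPMSmooth B)
    (hB0 : 0 ≤ B) (hI : I.FiniteOpt) : Measurable fun μ => I.opt (cubeProj m μ) := by
  have h1 : Continuous (cubeProj m) := by unfold cubeProj; fun_prop
  exact ((hB.continuousOn_opt hB0 hI).comp_continuous h1 cubeProj_mem).measurable

end InstanceBounds

/-! ### What the history σ-algebra makes measurable. -/

section History

variable {m d : ℕ} {𝒮 : Type*} [MeasurableSpace 𝒮] {Ω : Type*} (φ : ℕ → Ω → FeatureMap m d)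
  (S : ℕ → Ω → 𝒮) (X : ℕ → Ω → Fin m → Bool) (τ : ℕ → Ω → Finset (Fin m))

theorem measurable_history_feature {s t : ℕ} (hst : s ≤ t) :
    Measurable[history φ S X τ t] (φ s) := by
  rcases hst.eq_or_lt with rfl | h
  · exact measurable_iff_comap_le.mpr le_sup_right
  · refine measurable_iff_comap_le.mpr (le_trans ?_ le_sup_left)
    exact le_iSup₂_of_le s h (le_sup_left.trans (le_sup_left.trans le_sup_left))

theorem measurable_history_triggered {s t : ℕ} (hst : s < t) :
    Measurable[history φ S X τ t] (τ s) := by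
  refine measurable_iff_comap_le.mpr (le_trans ?_ le_sup_left)
  exact le_iSup₂_of_le s hst (le_sup_right.trans le_sup_left)

theorem measurable_history_observed {s t : ℕ} (hst : s < t) :
    Measurable[history φ S X τ t] fun ω i => if i ∈ τ s ω then X s ω i else false := by
  refine measurable_iff_comap_le.mpr (le_trans ?_ le_sup_left)
  exact le_iSup₂_of_le s hst le_sup_right

variable {φ S X τ}

theorem measurable_observed [MeasurableSpace Ω] {s : ℕ} (hX : Measurable (X s))
    (hτ : Measurable (τ s)) : Measurable fun ω i => if i ∈ τ s ω then X s ω i else false :=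
  measurable_pi_iff.mpr fun i => Measurable.ite
    (hτ (MeasurableSet.of_discrete (s := {A | i ∈ A}))) ((measurable_pi_apply i).comp hX)
    measurable_const

end History

/-! ### Conditional laws along a run and the self-normalized concentration bound. -/

namespace IsC2UCBTRun

variable {m d : ℕ} {𝒮 : Type*} [MeasurableSpace 𝒮] {Ω : Type*} [MeasurableSpace Ω]
  {P : Measure Ω} [IsProbabilityMeasure P] {I : C2MABT m d 𝒮} {θ : EuclideanSpace ℝ (Fin d)}
  {O : Kernel (Fin m → ℝ) 𝒮} {γ : ℝ} {T : ℕ} {φ : ℕ → Ω → FeatureMap m d} {S : ℕ → Ω → 𝒮}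
  {X : ℕ → Ω → Fin m → Bool} {τ : ℕ → Ω → Finset (Fin m)}

omit [IsProbabilityMeasure P] in
theorem history_le (hrun : IsC2UCBTRun P I θ O γ T φ S X τ) (t : ℕ) :
    history φ S X τ t ≤ (inferInstance : MeasurableSpace Ω) :=
  sup_le (iSup₂_le fun s _ => sup_le (sup_le (sup_le (hrun.measurable_φ s).comap_le
    (hrun.measurable_S s).comap_le) (hrun.measurable_τ s).comap_le)
    (measurable_observed (hrun.measurable_X s) (hrun.measurable_τ s)).comap_le)
    (hrun.measurable_φ t).comap_le

omit [IsProbabilityMeasure P] in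
theorem history_sup_le (hrun : IsC2UCBTRun P I θ O γ T φ S X τ) (t : ℕ) :
    history φ S X τ t ⊔ MeasurableSpace.comap (S t) inferInstance ≤
      (inferInstance : MeasurableSpace Ω) :=
  sup_le (hrun.history_le t) (hrun.measurable_S t).comap_le

omit [IsProbabilityMeasure P] in
theorem mean_mem_meanVectors (hrun : IsC2UCBTRun P I θ O γ T φ S X τ) (hθ : θ ∈ I.Θ) {t : ℕ}
    (ht : t < T) (ω : Ω) : meanVec θ (φ t ω) ∈ I.meanVectors :=
  ⟨θ, hθ, φ t ω, hrun.φ_mem t ht ω, rfl⟩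

omit [IsProbabilityMeasure P] in
theorem mean_mem_unitCube (hrun : IsC2UCBTRun P I θ O γ T φ S X τ) (hθ : θ ∈ I.Θ) {t : ℕ}
    (ht : t < T) (ω : Ω) : meanVec θ (φ t ω) ∈ unitCube m :=
  I.mean_mem θ hθ _ (hrun.φ_mem t ht ω)

/-- The tower property for a function of the history, the action, the outcomes and the
triggered set of a round. -/
theorem lintegral_outcome (hrun : IsC2UCBTRun P I θ O γ T φ S X τ) {t : ℕ} (ht : t < T)
    {f : (Fin m → Bool) → Finset (Fin m) → Ω → ENNReal}
    (hf : ∀ x A,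
      Measurable[history φ S X τ t ⊔ MeasurableSpace.comap (S t) inferInstance] (f x A)) :
    ∫⁻ ω, f (X t ω) (τ t ω) ω ∂P = ∫⁻ ω, ∑ x, ∑ A, f x A ω *
      ENNReal.ofReal (bernoulliWeight (meanVec θ (φ t ω)) x * (I.Dtrig (S t ω) x A).toReal) ∂P := by
  have hle := hrun.history_sup_le t
  have hf' : ∀ x A, Measurable (f x A) := fun x A => (hf x A).mono hle le_rfl
  have hF : ∀ x A, MeasurableSet {ω | X t ω = x ∧ τ t ω = A} := fun x A =>
    (hrun.measurable_X t (measurableSet_singleton x)).inter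
      (hrun.measurable_τ t (measurableSet_singleton A))
  have hw : ∀ x A, Measurable fun ω => ENNReal.ofReal
      (bernoulliWeight (meanVec θ (φ t ω)) x * (I.Dtrig (S t ω) x A).toReal) := fun x A =>
    ((I.measurable_weight x A).comp ((measurable_meanVec θ (hrun.measurable_φ t)).prodMk
      (hrun.measurable_S t))).ennreal_ofReal
  have hfw : ∀ x A, Measurable fun ω => f x A ω * ENNReal.ofReal
      (bernoulliWeight (meanVec θ (φ t ω)) x * (I.Dtrig (S t ω) x A).toReal) := fun x A =>
    (hf' x A).mul (hw x A)
  have e : ∀ ω, f (X t ω) (τ t ω) ω =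
      ∑ x, ∑ A, {ω | X t ω = x ∧ τ t ω = A}.indicator (f x A) ω := by
    intro ω
    rw [Finset.sum_eq_single (X t ω), Finset.sum_eq_single (τ t ω)]
    · simp
    · intro A _ hA
      exact Set.indicator_of_notMem (fun h => hA h.2.symm) _
    · simp
    · intro x _ hx
      exact Finset.sum_eq_zero fun A _ => Set.indicator_of_notMem (fun h => hx h.1.symm) _
    · simp
  simp only [e]
  rw [lintegral_finsetSum _ fun x _ => Finset.measurable_sum _ fun A _ =>
      (hf' x A).indicator (hF x A),
    lintegral_finsetSum _ fun x _ => Finset.measurable_sum _ fun A _ => hfw x A]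
  refine Finset.sum_congr rfl fun x _ => ?_
  rw [lintegral_finsetSum _ fun A _ => (hf' x A).indicator (hF x A),
    lintegral_finsetSum _ fun A _ => hfw x A]
  refine Finset.sum_congr rfl fun A _ => ?_
  rw [lintegral_indicator (hF x A)]
  exact setLIntegral_eq_lintegral_mul_of_condExp hle (hF x A) (hrun.outcome_law t ht x A) (hf x A)

/-- Almost surely at most `K` arms are triggered in a round. -/
theorem ae_card_triggered_le (hrun : IsC2UCBTRun P I θ O γ T φ S X τ) (hθ : θ ∈ I.Θ) {t : ℕ}
    (ht : t < T) : ∀ᵐ ω ∂P, (τ t ω).card ≤ I.batchSize := by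
  -- The integrand is the indicator of an oversized triggered set. A set `A` of positive conditional
  -- weight consists of arms with positive triggering probability, so it has at most `K` elements
  -- and the integral vanishes.
  have h := hrun.lintegral_outcome ht
    (f := fun _ A _ => if A.card ≤ I.batchSize then 0 else 1) fun _ _ => measurable_const
  have hz : ∀ ω, ∑ x, ∑ A : Finset (Fin m), (if A.card ≤ I.batchSize then (0 : ENNReal) else 1) *
      ENNReal.ofReal (bernoulliWeight (meanVec θ (φ t ω)) x * (I.Dtrig (S t ω) x A).toReal) =
      0 := by
    intro ω
    refine Finset.sum_eq_zero fun x _ => Finset.sum_eq_zero fun A _ => ?_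
    split_ifs with hA
    · rw [zero_mul]
    · rw [one_mul, ENNReal.ofReal_eq_zero]
      by_contra! hpos
      refine hA (C2MABT.card_le_batchSize (hrun.mean_mem_meanVectors hθ ht ω) (S t ω)
        fun i hi => hpos.trans_le ?_)
      exact C2MABT.weight_le_trigProb (hrun.mean_mem_unitCube hθ ht ω) _ x hi
  simp only [hz, lintegral_zero] at h
  have hm : Measurable fun ω => if (τ t ω).card ≤ I.batchSize then (0 : ENNReal) else 1 :=
    (measurable_of_countable fun A : Finset (Fin m) =>
      if A.card ≤ I.batchSize then (0 : ENNReal) else 1).comp (hrun.measurable_τ t)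
  filter_upwards [(lintegral_eq_zero_iff hm).mp h] with ω hω
  by_contra hA
  simp [hA] at hω

/-- The triggering probability of an arm is its conditional probability of being triggered. -/
theorem lintegral_sum_triggered (hrun : IsC2UCBTRun P I θ O γ T φ S X τ) (hθ : θ ∈ I.Θ) {t : ℕ}
    (ht : t < T) {f : Fin m → Ω → ENNReal} (hf : ∀ i, Measurable[history φ S X τ t] (f i)) :
    ∫⁻ ω, ∑ i ∈ τ t ω, f i ω ∂P = ∫⁻ ω, ∑ i, f i ω *
      ENNReal.ofReal (I.trigProb (meanVec θ (φ t ω)) (S t ω) i) ∂P := by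
  have hf' : ∀ i, Measurable[history φ S X τ t ⊔ MeasurableSpace.comap (S t) inferInstance] (f i) :=
    fun i => (hf i).mono le_sup_left le_rfl
  rw [hrun.lintegral_outcome ht (f := fun _ A ω => ∑ i ∈ A, f i ω)
    fun _ A => Finset.measurable_sum _ fun i _ => hf' i]
  refine lintegral_congr fun ω => ?_
  have hw := fun x A => C2MABT.weight_nonneg (I := I) (hrun.mean_mem_unitCube hθ ht ω) (S t ω) x A
  have hite : ∀ (i : Fin m) (x : Fin m → Bool) (A : Finset (Fin m)), 0 ≤ if i ∈ A then
      bernoulliWeight (meanVec θ (φ t ω)) x * (I.Dtrig (S t ω) x A).toReal else 0 := by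
    intro i x A
    split_ifs
    · exact hw x A
    · exact le_rfl
  calc _ = ∑ x : Fin m → Bool, ∑ A : Finset (Fin m), ∑ i, f i ω * ENNReal.ofReal (if i ∈ A then
        bernoulliWeight (meanVec θ (φ t ω)) x * (I.Dtrig (S t ω) x A).toReal else 0) := by
        refine Finset.sum_congr rfl fun x _ => Finset.sum_congr rfl fun A _ => ?_
        rw [Finset.sum_mul, ← Finset.univ_inter A, ← Finset.sum_ite_mem, Finset.univ_inter]
        refine Finset.sum_congr rfl fun i _ => ?_
        split_ifs <;> simp
    _ = ∑ i, ∑ x : Fin m → Bool, ∑ A : Finset (Fin m), f i ω * ENNReal.ofReal (if i ∈ A then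
        bernoulliWeight (meanVec θ (φ t ω)) x * (I.Dtrig (S t ω) x A).toReal else 0) := by
        rw [Finset.sum_comm]
        rw [Finset.sum_congr rfl fun A _ => Finset.sum_comm, Finset.sum_comm]
        refine Finset.sum_congr rfl fun i _ => Finset.sum_comm
    _ = _ := by
        refine Finset.sum_congr rfl fun i _ => ?_
        rw [C2MABT.trigProb, ENNReal.ofReal_sum_of_nonneg fun x _ =>
          Finset.sum_nonneg fun A _ => hite i x A, Finset.mul_sum]
        refine Finset.sum_congr rfl fun x _ => ?_
        rw [ENNReal.ofReal_sum_of_nonneg fun A _ => hite i x A, Finset.mul_sum]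

/-- The action drawn by the oracle satisfies the approximation guarantee with conditional
probability at least `β`. -/
theorem le_setLIntegral_oracle [IsMarkovKernel O] {α β B : ℝ}
    (hrun : IsC2UCBTRun P I θ O γ T φ S X τ) (hO : I.IsApproxOracle α β O) [Nonempty 𝒮]
    (hB : I.TPMSmooth B) (hB0 : 0 ≤ B) (hI : I.FiniteOpt) {t : ℕ} (ht : t < T)
    {h : Ω → ENNReal} (hh : Measurable[history φ S X τ t] h) (hfin : ∫⁻ ω, h ω ∂P ≠ ⊤)
    {u : Ω → Fin m → ℝ} (hu : u = fun ω => ucb γ (confRadius d I.batchSize T γ (1 / T))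
      (fun s => φ s ω) (fun s => X s ω) (fun s => τ s ω) t) :
    ENNReal.ofReal β * ∫⁻ ω, h ω ∂P ≤ ∫⁻ ω in {ω | α * I.opt (u ω) ≤ I.r (S t ω) (u ω)},
      h ω ∂P := by
  have hle := hrun.history_le t
  have hum : Measurable[history φ S X τ t] u := by
    rw [hu]
    exact @measurable_ucb m d Ω (history φ S X τ t) φ X τ t γ _
      (fun s hs => measurable_history_feature φ S X τ hs)
      (fun s hs => measurable_history_triggered φ S X τ hs)
      (fun s hs => measurable_history_observed φ S X τ hs)
  have huc : ∀ ω, u ω ∈ unitCube m := fun ω => by rw [hu]; exact ucb_mem_unitCube _ _ _ _ _ _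
  -- The projection makes the success event a measurable set of pairs; it changes nothing at `u ω`,
  -- which lies in the cube.
  let D : Set ((Fin m → ℝ) × 𝒮) := {p | α * I.opt (cubeProj m p.1) ≤ I.r p.2 p.1}
  have hD : MeasurableSet D := measurableSet_le
    (((hB.measurable_opt_cubeProj hB0 hI).comp measurable_fst).const_mul α) I.measurable_r
  have key := setLIntegral_prod_eq_lintegral_mul_of_condExp hle hum (hrun.measurable_S t) O
    (fun B hB => by rw [hu]; exact hrun.action_law t ht B hB) hh hfin hD
  have e : {ω | (u ω, S t ω) ∈ D} = {ω | α * I.opt (u ω) ≤ I.r (S t ω) (u ω)} := by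
    ext ω
    simp only [D, Set.mem_ofPred_eq, cubeProj_of_mem (huc ω)]
  rw [e] at key
  rw [key, ← lintegral_const_mul' _ _ ENNReal.ofReal_ne_top]
  refine lintegral_mono fun ω => ?_
  simp only
  rw [mul_comm]
  refine mul_le_mul_right ?_ _
  have h1 := hO (u ω) (huc ω)
  have e2 : Prod.mk (u ω) ⁻¹' D = {a | α * I.opt (u ω) ≤ I.r a (u ω)} := by
    ext a
    simp only [D, Set.mem_preimage, Set.mem_ofPred_eq, cubeProj_of_mem (huc ω)]
  rw [e2]
  exact (ENNReal.ofReal_le_ofReal h1).trans ENNReal.ofReal_toReal_le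

/-- The supermartingale property in a fixed direction `v`: given the history and the action, the
factor gained in round `t` has mean at most `1` by `C2MABT.TriggeringByObserved.sum_exp_le_one` with
`l i = v · φ_t(i)`. -/
theorem lintegral_exp_logExpMartingale_le_one (hrun : IsC2UCBTRun P I θ O γ T φ S X τ)
    (hI : I.TriggeringByObserved) (hθ : θ ∈ I.Θ) (v : Fin d → ℝ) {t : ℕ} (ht : t ≤ T) :
    ∫⁻ ω, ENNReal.ofReal (Real.exp (logExpMartingale γ θ.ofLp (fun s => φ s ω) (fun s => X s ω)
      (fun s => τ s ω) t v)) ∂P ≤ 1 := by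
  induction t with
  | zero => simp [logExpMartingale_zero]
  | succ t ih =>
    have ht' : t < T := ht
    refine le_trans ?_ (ih ht'.le)
    let l : Ω → Fin m → ℝ := fun ω i => v ⬝ᵥ (φ t ω i).ofLp
    let N : Ω → ℝ := fun ω => Real.exp (logExpMartingale γ θ.ofLp (fun s => φ s ω)
      (fun s => X s ω) (fun s => τ s ω) t v)
    let inc : (Fin m → Bool) → Finset (Fin m) → Ω → ℝ := fun x A ω =>
      Real.exp (∑ i ∈ A, (l ω i * ((if x i then 1 else 0) - meanVec θ (φ t ω) i) - l ω i ^ 2 / 2))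
    have hφm := measurable_history_feature φ S X τ (le_refl t)
    have hN : Measurable[history φ S X τ t] N := by
      have := @measurable_logExpMartingale m d Ω (history φ S X τ t) φ X τ t γ θ.ofLp
        (fun s hs => measurable_history_feature φ S X τ hs.le)
        (fun s hs => measurable_history_triggered φ S X τ hs)
        (fun s hs => measurable_history_observed φ S X τ hs)
      exact Real.measurable_exp.comp (this.comp (measurable_id.prodMk measurable_const))
    have hl : ∀ i, Measurable[history φ S X τ t] fun ω => l ω i := fun i =>
      @Measurable.dotProduct Ω _ (history φ S X τ t) _ _ _ measurable_const
        (@FeatureMap.measurable_ofLp m d Ω (history φ S X τ t) _ hφm i)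
    have hmean : ∀ i, Measurable[history φ S X τ t] fun ω => meanVec θ (φ t ω) i := fun i =>
      (measurable_pi_apply i).comp (@measurable_meanVec m d Ω (history φ S X τ t) θ _ hφm)
    have hinc : ∀ x A, Measurable[history φ S X τ t] (inc x A) := fun x A =>
      Real.measurable_exp.comp (Finset.measurable_sum _ fun i _ =>
        ((hl i).mul (measurable_const.sub (hmean i))).sub (((hl i).pow_const 2).div_const 2))
    have e : ∀ ω, ENNReal.ofReal (Real.exp (logExpMartingale γ θ.ofLp (fun s => φ s ω)
        (fun s => X s ω) (fun s => τ s ω) (t + 1) v)) =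
        ENNReal.ofReal (N ω * inc (X t ω) (τ t ω) ω) := by
      intro ω
      rw [logExpMartingale_succ, Real.exp_add]
    simp only [e]
    rw [hrun.lintegral_outcome ht' (f := fun x A ω => ENNReal.ofReal (N ω * inc x A ω))
      fun x A => ((hN.mul (hinc x A)).ennreal_ofReal).mono le_sup_left le_rfl]
    refine lintegral_mono fun ω => ?_
    have hc := hrun.mean_mem_unitCube hθ ht' ω
    have hw := fun x A => C2MABT.weight_nonneg (I := I) hc (S t ω) x A
    have hN0 : 0 ≤ N ω := (Real.exp_pos _).le
    have hinc0 : ∀ x A, 0 ≤ inc x A ω := fun x A => (Real.exp_pos _).le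
    calc _ = ENNReal.ofReal (N ω * ∑ x : Fin m → Bool, ∑ A : Finset (Fin m),
          bernoulliWeight (meanVec θ (φ t ω)) x * (I.Dtrig (S t ω) x A).toReal * inc x A ω) := by
          rw [Finset.mul_sum, ENNReal.ofReal_sum_of_nonneg fun x _ => mul_nonneg hN0
            (Finset.sum_nonneg fun A _ => mul_nonneg (hw x A) (hinc0 x A))]
          refine Finset.sum_congr rfl fun x _ => ?_
          rw [Finset.mul_sum, ENNReal.ofReal_sum_of_nonneg fun A _ => mul_nonneg hN0
            (mul_nonneg (hw x A) (hinc0 x A))]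
          refine Finset.sum_congr rfl fun A _ => ?_
          rw [← ENNReal.ofReal_mul (mul_nonneg hN0 (hinc0 x A))]
          congr 1
          ring
      _ ≤ ENNReal.ofReal (N ω) := by
          refine ENNReal.ofReal_le_ofReal (mul_le_of_le_one_right hN0 ?_)
          exact hI.sum_exp_le_one (S t ω) hc (l ω)

/-- The exponential moment bound of the method of mixtures. -/
theorem lintegral_exp_noise_le (hrun : IsC2UCBTRun P I θ O γ T φ S X τ)
    (hI : I.TriggeringByObserved) (hθ : θ ∈ I.Θ) (hγ : 0 < γ) {t : ℕ} (ht : t ≤ T) :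
    ∫⁻ ω, ENNReal.ofReal (Real.exp ((noiseVec γ θ.ofLp (fun s => φ s ω) (fun s => X s ω)
      (fun s => τ s ω) t ⬝ᵥ (gram γ (fun s => φ s ω) (fun s => τ s ω) t)⁻¹ *ᵥ
        noiseVec γ θ.ofLp (fun s => φ s ω) (fun s => X s ω) (fun s => τ s ω) t) / 2) *
      (√(gram γ (fun s => φ s ω) (fun s => τ s ω) t).det)⁻¹) ∂P ≤
      ENNReal.ofReal (√(γ ^ d))⁻¹ := by
  set M := fun ω => logExpMartingale γ θ.ofLp (fun s => φ s ω) (fun s => X s ω)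
    (fun s => τ s ω) t with hM
  have hMm : Measurable fun p : Ω × (Fin d → ℝ) => M p.1 p.2 :=
    measurable_logExpMartingale γ θ.ofLp (fun s _ => hrun.measurable_φ s)
      (fun s _ => hrun.measurable_τ s)
      (fun s _ => measurable_observed (hrun.measurable_X s) (hrun.measurable_τ s))
  have hprior : Measurable fun v : Fin d → ℝ =>
      ENNReal.ofReal (Real.exp (-(γ * (v ⬝ᵥ v)) / 2)) := by
    unfold dotProduct; fun_prop
  have hG := fun ω => gram_posDef hγ (fun s => φ s ω) (fun s => τ s ω) t
  have hγI : (γ • (1 : Matrix (Fin d) (Fin d) ℝ)).PosDef := Matrix.PosDef.one.smul hγ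
  -- Averaging over a Gaussian prior of precision `γ` restores the regularizer, so the exponent
  -- becomes `v·s - (v·Gv)/2` with the full Gram matrix.
  have hmix : ∀ ω, ∫⁻ v : Fin d → ℝ, ENNReal.ofReal (Real.exp (M ω v)) *
      ENNReal.ofReal (Real.exp (-(γ * (v ⬝ᵥ v)) / 2)) =
      ENNReal.ofReal (Real.exp ((noiseVec γ θ.ofLp (fun s => φ s ω) (fun s => X s ω)
      (fun s => τ s ω) t ⬝ᵥ (gram γ (fun s => φ s ω) (fun s => τ s ω) t)⁻¹ *ᵥ
        noiseVec γ θ.ofLp (fun s => φ s ω) (fun s => X s ω) (fun s => τ s ω) t) / 2) *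
      (√(gram γ (fun s => φ s ω) (fun s => τ s ω) t).det)⁻¹) * gaussianMass (Fin d) := by
    intro ω
    rw [← (hG ω).lintegral_gaussian_tilted]
    refine lintegral_congr fun v => ?_
    rw [← ENNReal.ofReal_mul (Real.exp_pos _).le, ← Real.exp_add, hM]
    simp only [logExpMartingale]
    congr 2
    ring
  have hpr : ∫⁻ v : Fin d → ℝ, ENNReal.ofReal (Real.exp (-(γ * (v ⬝ᵥ v)) / 2)) =
      ENNReal.ofReal (√(γ ^ d))⁻¹ * gaussianMass (Fin d) := by
    have := hγI.lintegral_gaussian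
    simpa [Matrix.smul_mulVec] using this
  rw [← ENNReal.mul_le_mul_iff_left gaussianMass_ne_zero (gaussianMass_ne_top (n := Fin d)), ← hpr,
    ← lintegral_mul_const' _ _ gaussianMass_ne_top]
  calc _ = ∫⁻ ω, (∫⁻ v : Fin d → ℝ, ENNReal.ofReal (Real.exp (M ω v)) *
        ENNReal.ofReal (Real.exp (-(γ * (v ⬝ᵥ v)) / 2))) ∂P := lintegral_congr fun ω => (hmix ω).symm
    _ = ∫⁻ v : Fin d → ℝ, (∫⁻ ω, ENNReal.ofReal (Real.exp (M ω v)) *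
        ENNReal.ofReal (Real.exp (-(γ * (v ⬝ᵥ v)) / 2)) ∂P) :=
        lintegral_lintegral_swap ((hMm.exp.ennreal_ofReal).mul
          (hprior.comp measurable_snd)).aemeasurable
    _ ≤ _ := by
        refine lintegral_mono fun v => ?_
        simp only
        rw [lintegral_mul_const' _ _ ENNReal.ofReal_ne_top]
        exact mul_le_of_le_one_left zero_le
          (hrun.lintegral_exp_logExpMartingale_le_one hI hθ v ht)

/-- The self-normalized concentration bound at a fixed round. -/
theorem measure_confidence_fails_le (hrun : IsC2UCBTRun P I θ O γ T φ S X τ)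
    (hI : I.TriggeringByObserved) (hθ : θ ∈ I.Θ) (hγ : 0 < γ) (hT : 0 < T) {t : ℕ} (ht : t < T) :
    P {ω | √(Real.log ((γ + I.batchSize * T / d) ^ d / (γ ^ d * (1 / (T : ℝ)) ^ 2))) <
      √(noiseVec γ θ.ofLp (fun s => φ s ω) (fun s => X s ω) (fun s => τ s ω) t ⬝ᵥ
        (gram γ (fun s => φ s ω) (fun s => τ s ω) t)⁻¹ *ᵥ
        noiseVec γ θ.ofLp (fun s => φ s ω) (fun s => X s ω) (fun s => τ s ω) t)} ≤
      ENNReal.ofReal (1 / T) := by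
  have hT' : (0 : ℝ) < T := by exact_mod_cast hT
  set Q := fun ω => noiseVec γ θ.ofLp (fun s => φ s ω) (fun s => X s ω) (fun s => τ s ω) t ⬝ᵥ
        (gram γ (fun s => φ s ω) (fun s => τ s ω) t)⁻¹ *ᵥ
        noiseVec γ θ.ofLp (fun s => φ s ω) (fun s => X s ω) (fun s => τ s ω) t with hQ
  set Δ := fun ω => (gram γ (fun s => φ s ω) (fun s => τ s ω) t).det with hΔ
  set D := (γ + I.batchSize * T / d) ^ d with hD
  have hDpos : 0 < D := pow_pos (by positivity) d
  have hΔpos : ∀ ω, 0 < Δ ω := fun ω =>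
    (gram_posDef hγ (fun s => φ s ω) (fun s => τ s ω) t).det_pos
  have hγd : 0 < γ ^ d := pow_pos hγ d
  have hQm : Measurable Q := measurable_noise_quadForm γ θ.ofLp (fun s _ => hrun.measurable_φ s)
    (fun s _ => hrun.measurable_τ s)
    (fun s _ => measurable_observed (hrun.measurable_X s) (hrun.measurable_τ s))
  have hΔm : Measurable Δ := Matrix.measurable_det_comp (measurable_gram_apply γ
    (fun s _ => hrun.measurable_φ s) (fun s _ => hrun.measurable_τ s))
  set Z := fun ω => ENNReal.ofReal (Real.exp (Q ω / 2) * (√(Δ ω))⁻¹) with hZ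
  have hZm : Measurable Z := ((hQm.div_const 2).exp.mul hΔm.sqrt.inv).ennreal_ofReal
  have hcard : ∀ᵐ ω ∂P, ∀ s < t, (τ s ω).card ≤ I.batchSize :=
    ae_all_iff.mpr fun s => by
      by_cases hs : s < t
      · filter_upwards [hrun.ae_card_triggered_le hθ (hs.trans ht)] with ω hω _ using hω
      · exact Filter.Eventually.of_forall fun ω h => absurd h hs
  -- The Markov level: the mean of `Z` is at most `(√(γ ^ d))⁻¹`, so exceeding `c` has probability
  -- at most `1/T`.
  set c : ℝ := T * (√(γ ^ d))⁻¹ with hc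
  have hcpos : 0 < c := by positivity
  -- The inclusion holds only almost surely: replacing the random determinant by the deterministic
  -- `D` requires at most `K` triggered arms per round.
  have hsub : {ω | √(Real.log (D / (γ ^ d * (1 / (T : ℝ)) ^ 2))) < √(Q ω)} ≤ᵐ[P]
      {ω | ENNReal.ofReal c ≤ Z ω} := by
    filter_upwards [hcard] with ω hω hlt
    have hlt : √(Real.log (D / (γ ^ d * (1 / (T : ℝ)) ^ 2))) < √(Q ω) := hlt
    refine ENNReal.ofReal_le_ofReal ?_
    have hdet : Δ ω ≤ D := det_gram_le hγ ht.le
      (fun s hs i => I.norm_feature_le _ (hrun.φ_mem s (hs.trans ht) ω) i) hω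
    have h1 : Real.log (D / (γ ^ d * (1 / (T : ℝ)) ^ 2)) < Q ω :=
      (Real.sqrt_lt_sqrt_iff_of_pos
        (Real.sqrt_pos.mp ((Real.sqrt_nonneg _).trans_lt hlt))).mp hlt
    have h2 : √(D / (γ ^ d * (1 / (T : ℝ)) ^ 2)) ≤ Real.exp (Q ω / 2) := by
      rw [Real.exp_half]
      refine Real.sqrt_le_sqrt ?_
      rw [← Real.exp_log (show 0 < D / (γ ^ d * (1 / (T : ℝ)) ^ 2) by positivity)]
      exact Real.exp_le_exp.mpr h1.le
    have h3 : √(D / (γ ^ d * (1 / (T : ℝ)) ^ 2)) = √D * c := by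
      rw [Real.sqrt_div hDpos.le, Real.sqrt_mul hγd.le, Real.sqrt_sq (by positivity), hc]
      field_simp
    have h4 : √(Δ ω) ≤ √D := Real.sqrt_le_sqrt hdet
    have h5 : 0 < √(Δ ω) := Real.sqrt_pos.mpr (hΔpos ω)
    rw [← div_eq_mul_inv, le_div_iff₀ h5]
    rw [h3] at h2
    exact (mul_comm c _ ▸ mul_le_mul_of_nonneg_right h4 hcpos.le).trans h2
  refine (measure_mono_ae hsub).trans ?_
  refine (meas_ge_le_lintegral_div hZm.aemeasurable (by simpa using hcpos)
    ENNReal.ofReal_ne_top).trans ?_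
  refine (ENNReal.div_le_div_right (hrun.lintegral_exp_noise_le hI hθ hγ ht.le) _).trans ?_
  rw [← ENNReal.ofReal_div_of_pos hcpos]
  refine ENNReal.ofReal_le_ofReal (le_of_eq ?_)
  rw [hc]
  have : 0 < √(γ ^ d) := Real.sqrt_pos.mpr hγd
  field_simp

end IsC2UCBTRun

/-! ### Per-round gap and reduction of the regret to widths of triggered arms. -/

namespace IsC2UCBTRun

variable {m d : ℕ} {𝒮 : Type*} [MeasurableSpace 𝒮] {Ω : Type*} [MeasurableSpace Ω]
  {P : Measure Ω} [IsProbabilityMeasure P] {I : C2MABT m d 𝒮} {θ : EuclideanSpace ℝ (Fin d)}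
  {O : Kernel (Fin m → ℝ) 𝒮} {γ : ℝ} {T : ℕ} {φ : ℕ → Ω → FeatureMap m d} {S : ℕ → Ω → 𝒮}
  {X : ℕ → Ω → Fin m → Bool} {τ : ℕ → Ω → Finset (Fin m)}

/-- The clipped confidence width of an arm. -/
def clippedWidth (γ ρ : ℝ) (φ : ℕ → Ω → FeatureMap m d) (τ : ℕ → Ω → Finset (Fin m)) (t : ℕ)
    (i : Fin m) (ω : Ω) : ℝ :=
  min 1 (2 * ρ * armWidth γ (fun s => φ s ω) (fun s => τ s ω) t i)

omit [MeasurableSpace Ω] in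
theorem clippedWidth_nonneg {ρ : ℝ} (hρ : 0 ≤ ρ) (t : ℕ) (i : Fin m) (ω : Ω) :
    0 ≤ clippedWidth γ ρ φ τ t i ω :=
  le_min zero_le_one (mul_nonneg (by positivity) (armWidth_nonneg _ _ _ _ _))

omit [MeasurableSpace Ω] in
theorem clippedWidth_le_one (ρ : ℝ) (t : ℕ) (i : Fin m) (ω : Ω) :
    clippedWidth γ ρ φ τ t i ω ≤ 1 := min_le_left _ _

/-- The event that the confidence ellipsoid of round `t` misses the true parameter. -/
def confidenceFails (K : ℕ) (θ : EuclideanSpace ℝ (Fin d)) (γ : ℝ) (T : ℕ)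
    (φ : ℕ → Ω → FeatureMap m d) (X : ℕ → Ω → Fin m → Bool) (τ : ℕ → Ω → Finset (Fin m))
    (t : ℕ) : Set Ω :=
  {ω | √(Real.log ((γ + K * T / d) ^ d / (γ ^ d * (1 / (T : ℝ)) ^ 2))) <
      √(noiseVec γ θ.ofLp (fun s => φ s ω) (fun s => X s ω) (fun s => τ s ω) t ⬝ᵥ
        (gram γ (fun s => φ s ω) (fun s => τ s ω) t)⁻¹ *ᵥ
        noiseVec γ θ.ofLp (fun s => φ s ω) (fun s => X s ω) (fun s => τ s ω) t)}

omit [IsProbabilityMeasure P] in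
theorem measurableSet_confidenceFails (hrun : IsC2UCBTRun P I θ O γ T φ S X τ) (t : ℕ) :
    MeasurableSet (confidenceFails I.batchSize θ γ T φ X τ t) :=
  measurableSet_lt measurable_const (measurable_noise_quadForm γ θ.ofLp
    (fun s _ => hrun.measurable_φ s) (fun s _ => hrun.measurable_τ s)
    (fun s _ => measurable_observed (hrun.measurable_X s) (hrun.measurable_τ s))).sqrt

omit [IsProbabilityMeasure P] in
/-- The per-round gap of a run in which the oracle succeeds. -/
theorem gap_le_of_oracle_succeeds {α B : ℝ} (hα : α ∈ Set.Icc (0 : ℝ) 1)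
    (hrun : IsC2UCBTRun P I θ O γ T φ S X τ) [Nonempty 𝒮] (hB : I.TPMSmooth B) (hB0 : 0 ≤ B)
    (hmono : I.Monotonicity) (hI : I.FiniteOpt) (hθ : θ ∈ I.Θ) (hθ1 : ‖θ‖ ≤ 1) (hγ : 0 < γ)
    {t : ℕ} (ht : t < T) {ω : Ω} {u : Fin m → ℝ}
    (hu : u = ucb γ (confRadius d I.batchSize T γ (1 / T))
      (fun s => φ s ω) (fun s => X s ω) (fun s => τ s ω) t)
    (hN : α * I.opt u ≤ I.r (S t ω) u) :
    α * I.opt (meanVec θ (φ t ω)) - I.r (S t ω) (meanVec θ (φ t ω)) ≤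
      B * (∑ i, I.trigProb (meanVec θ (φ t ω)) (S t ω) i *
          clippedWidth γ (confRadius d I.batchSize T γ (1 / T)) φ τ t i ω +
        (confidenceFails I.batchSize θ γ T φ X τ t).indicator
          (fun _ => 2 * (I.batchSize : ℝ)) ω) := by
  have hμ := hrun.mean_mem_unitCube hθ ht ω
  have hμM := hrun.mean_mem_meanVectors hθ ht ω
  have huc : u ∈ unitCube m := by rw [hu]; exact ucb_mem_unitCube _ _ _ _ _ _
  have hp := fun i => C2MABT.trigProb_nonneg (I := I) hμ (S t ω) i
  have hρ : 0 ≤ confRadius d I.batchSize T γ (1 / T) := by unfold confRadius; positivity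
  have hTPM := (abs_le.mp (hB (S t ω) _ hμ u huc)).2
  by_cases hE : ω ∈ confidenceFails I.batchSize θ γ T φ X τ t
  · rw [Set.indicator_of_mem hE]
    -- Without the ellipsoid, only `u` in the cube is known. Smoothness is applied once to `opt` and
    -- once to the reward of the action played, each time at cost `B * K`; this is the origin of `2
    -- * K`.
    have hK : ∀ a, ∑ i, I.trigProb (meanVec θ (φ t ω)) a i * |meanVec θ (φ t ω) i - u i| ≤
        I.batchSize := fun a => C2MABT.sum_trigProb_mul_le hμM a fun i =>
      abs_sub_le_one_of_mem_unitCube hμ huc i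
    have h1 := hB.opt_le hB0 hI hμ huc hK
    have h2 := mul_le_mul_of_nonneg_left (hK (S t ω)) hB0
    have h3 : 0 ≤ B * ∑ i, I.trigProb (meanVec θ (φ t ω)) (S t ω) i *
          clippedWidth γ (confRadius d I.batchSize T γ (1 / T)) φ τ t i ω :=
      mul_nonneg hB0 (Finset.sum_nonneg fun i _ =>
        mul_nonneg (hp i) (clippedWidth_nonneg hρ t i ω))
    have h4 : 0 ≤ B * (I.batchSize : ℝ) := by positivity
    have h5 := mul_le_mul_of_nonneg_left h1 hα.1
    have h6 : α * (B * (I.batchSize : ℝ)) ≤ B * I.batchSize := mul_le_of_le_one_left h4 hα.2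
    rw [mul_add]
    linarith
  · rw [Set.indicator_of_notMem hE, add_zero]
    have hc : ∀ i, |(φ t ω i).ofLp ⬝ᵥ thetaHat γ (fun s => φ s ω) (fun s => X s ω)
        (fun s => τ s ω) t - meanVec θ (φ t ω) i| ≤ confRadius d I.batchSize T γ (1 / T) *
        armWidth γ (fun s => φ s ω) (fun s => τ s ω) t i := fun i =>
      abs_dotProduct_thetaHat_sub_le hγ hθ1 (fun s => φ s ω) (fun s => X s ω) (fun s => τ s ω) t
        (not_lt.mp hE) i
    have h1 : I.opt (meanVec θ (φ t ω)) ≤ I.opt u := C2MABT.opt_mono hI hmono hμ huc fun i => by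
      rw [hu]; exact meanVec_le_ucb (φ := fun s => φ s ω) (hμ i) (hc i)
    have h2 : ∑ i, I.trigProb (meanVec θ (φ t ω)) (S t ω) i * |meanVec θ (φ t ω) i - u i| ≤
        ∑ i, I.trigProb (meanVec θ (φ t ω)) (S t ω) i *
          clippedWidth γ (confRadius d I.batchSize T γ (1 / T)) φ τ t i ω :=
      Finset.sum_le_sum fun i _ => mul_le_mul_of_nonneg_left (by
        rw [hu]
        exact abs_meanVec_sub_ucb_le (φ := fun s => φ s ω) (hμ i) (hc i)) (hp i)
    have h3 := mul_le_mul_of_nonneg_left h1 hα.1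
    have h4 := mul_le_mul_of_nonneg_left h2 hB0
    linarith

theorem _root_.integrable_of_measurable_of_mem_Icc {f : Ω → ℝ} (hf : Measurable f) {c : ℝ}
    (h0 : ∀ ω, 0 ≤ f ω) (hc : ∀ ω, f ω ≤ c) : Integrable f P :=
  Integrable.of_mem_Icc 0 c hf.aemeasurable (Filter.Eventually.of_forall fun ω => ⟨h0 ω, hc ω⟩)

omit [IsProbabilityMeasure P] in
theorem measurable_r_run (hrun : IsC2UCBTRun P I θ O γ T φ S X τ) (t : ℕ) :
    Measurable fun ω => I.r (S t ω) (meanVec θ (φ t ω)) :=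
  I.measurable_r_comp (measurable_meanVec θ (hrun.measurable_φ t)) (hrun.measurable_S t)

omit [IsProbabilityMeasure P] in
theorem measurable_trigProb_run (hrun : IsC2UCBTRun P I θ O γ T φ S X τ) (t : ℕ) (i : Fin m) :
    Measurable fun ω => I.trigProb (meanVec θ (φ t ω)) (S t ω) i :=
  I.measurable_trigProb_comp (measurable_meanVec θ (hrun.measurable_φ t)) (hrun.measurable_S t) i

theorem one_mem_unitCube : (fun _ => 1 : Fin m → ℝ) ∈ unitCube m := fun _ => by simp

omit [MeasurableSpace Ω] in
theorem measurable_history_clippedWidth (ρ : ℝ) (t : ℕ) (i : Fin m) :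
    Measurable[history φ S X τ t] (clippedWidth γ ρ φ τ t i) :=
  measurable_const.min (measurable_const.mul (@measurable_armWidth m d Ω (history φ S X τ t) φ τ t γ
    (fun _ hs => measurable_history_feature φ S X τ hs)
    (fun _ hs => measurable_history_triggered φ S X τ hs) i))

omit [IsProbabilityMeasure P] in
theorem measurable_sum_triggered (hrun : IsC2UCBTRun P I θ O γ T φ S X τ) {f : Fin m → Ω → ℝ}
    (hf : ∀ i, Measurable (f i)) (t : ℕ) : Measurable fun ω => ∑ i ∈ τ t ω, f i ω := by
  have e : (fun ω => ∑ i ∈ τ t ω, f i ω) = fun ω => ∑ i, if i ∈ τ t ω then f i ω else 0 := by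
    funext ω
    rw [Finset.sum_ite_mem, Finset.univ_inter]
  rw [e]
  exact Finset.measurable_sum _ fun i _ => Measurable.ite
    (hrun.measurable_τ t (MeasurableSet.of_discrete (s := {A | i ∈ A}))) (hf i) measurable_const

/-- By monotonicity the optimal reward is bounded by its value at the all-ones vector. Measurability
for the history, not just the ambient σ-algebra, lets it serve as a weight in the oracle guarantee.
-/
theorem integrable_opt_run (hrun : IsC2UCBTRun P I θ O γ T φ S X τ) [Nonempty 𝒮] {B : ℝ}
    (hB : I.TPMSmooth B) (hB0 : 0 ≤ B) (hmono : I.Monotonicity) (hI : I.FiniteOpt)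
    (hθ : θ ∈ I.Θ) {t : ℕ} (ht : t < T) :
    Measurable[history φ S X τ t] (fun ω => I.opt (meanVec θ (φ t ω))) ∧
      Integrable (fun ω => I.opt (meanVec θ (φ t ω))) P := by
  have hμ := hrun.mean_mem_unitCube hθ ht
  have e : (fun ω => I.opt (meanVec θ (φ t ω))) =
      fun ω => I.opt (cubeProj m (meanVec θ (φ t ω))) := by
    funext ω
    rw [cubeProj_of_mem (hμ ω)]
  have hm : Measurable[history φ S X τ t] (fun ω => I.opt (meanVec θ (φ t ω))) := by
    rw [e]
    exact (hB.measurable_opt_cubeProj hB0 hI).comp (@measurable_meanVec m d Ω (history φ S X τ t) θ _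
      (measurable_history_feature φ S X τ le_rfl))
  exact ⟨hm, integrable_of_measurable_of_mem_Icc (hm.mono (hrun.history_le t) le_rfl)
    (fun ω => C2MABT.opt_nonneg (hμ ω))
    (fun ω => C2MABT.opt_mono hI hmono (hμ ω) one_mem_unitCube fun i => (hμ ω i).2)⟩

theorem integrable_r_run (hrun : IsC2UCBTRun P I θ O γ T φ S X τ) [Nonempty 𝒮]
    (hmono : I.Monotonicity) (hI : I.FiniteOpt) (hθ : θ ∈ I.Θ) {t : ℕ} (ht : t < T) :
    Integrable (fun ω => I.r (S t ω) (meanVec θ (φ t ω))) P := by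
  have hμ := hrun.mean_mem_unitCube hθ ht
  exact integrable_of_measurable_of_mem_Icc (hrun.measurable_r_run t)
    (fun ω => C2MABT.r_nonneg (hμ ω) _)
    (fun ω => (hI.r_le_opt (hμ ω) _).trans
      (C2MABT.opt_mono hI hmono (hμ ω) one_mem_unitCube fun i => (hμ ω i).2))

/-- Trades the unobservable weights of TPM smoothness for the arms that actually enter the Gram
matrix, to which the elliptical potential applies. -/
theorem integral_sum_trigProb_mul (hrun : IsC2UCBTRun P I θ O γ T φ S X τ) (hθ : θ ∈ I.Θ) {t : ℕ}
    (ht : t < T) {f : Fin m → Ω → ℝ} (hf : ∀ i, Measurable[history φ S X τ t] (f i))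
    (hf0 : ∀ i ω, 0 ≤ f i ω) :
    ∫ ω, ∑ i, I.trigProb (meanVec θ (φ t ω)) (S t ω) i * f i ω ∂P =
      ∫ ω, ∑ i ∈ τ t ω, f i ω ∂P := by
  have hμ := hrun.mean_mem_unitCube hθ ht
  have hp := fun ω i => C2MABT.trigProb_nonneg (I := I) (hμ ω) (S t ω) i
  have hf' : ∀ i, Measurable (f i) := fun i => (hf i).mono (hrun.history_le t) le_rfl
  rw [integral_eq_lintegral_of_nonneg_ae (Filter.Eventually.of_forall fun ω =>
      Finset.sum_nonneg fun i _ => mul_nonneg (hp ω i) (hf0 i ω))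
      (Finset.measurable_sum _ fun i _ =>
        (hrun.measurable_trigProb_run t i).mul (hf' i)).aestronglyMeasurable,
    integral_eq_lintegral_of_nonneg_ae (Filter.Eventually.of_forall fun ω =>
      Finset.sum_nonneg fun i _ => hf0 i ω)
      (hrun.measurable_sum_triggered hf' t).aestronglyMeasurable]
  congr 1
  have h := hrun.lintegral_sum_triggered hθ ht (f := fun i ω => ENNReal.ofReal (f i ω))
    fun i => (hf i).ennreal_ofReal
  calc _ = ∫⁻ ω, ∑ i, ENNReal.ofReal (f i ω) *
        ENNReal.ofReal (I.trigProb (meanVec θ (φ t ω)) (S t ω) i) ∂P := by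
        refine lintegral_congr fun ω => ?_
        rw [ENNReal.ofReal_sum_of_nonneg fun i _ => mul_nonneg (hp ω i) (hf0 i ω)]
        refine Finset.sum_congr rfl fun i _ => ?_
        rw [mul_comm, ENNReal.ofReal_mul (hf0 i ω)]
    _ = _ := by
        rw [← h]
        refine lintegral_congr fun ω => ?_
        rw [ENNReal.ofReal_sum_of_nonneg fun i _ => hf0 i ω]

theorem integral_gap_le [IsMarkovKernel O] {α β B : ℝ} (hα : α ∈ Set.Icc (0 : ℝ) 1)
    (hβ : β ∈ Set.Icc (0 : ℝ) 1)
    (hrun : IsC2UCBTRun P I θ O γ T φ S X τ) (hO : I.IsApproxOracle α β O) [Nonempty 𝒮]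
    (hB : I.TPMSmooth B) (hB0 : 0 ≤ B) (hmono : I.Monotonicity) (hI : I.FiniteOpt)
    (hθ : θ ∈ I.Θ) (hθ1 : ‖θ‖ ≤ 1) (hγ : 0 < γ) {t : ℕ} (ht : t < T) :
    ∫ ω, (α * β * I.opt (meanVec θ (φ t ω)) - I.r (S t ω) (meanVec θ (φ t ω))) ∂P ≤
      B * (∫ ω, ∑ i ∈ τ t ω, clippedWidth γ (confRadius d I.batchSize T γ (1 / T)) φ τ t i ω ∂P +
        2 * I.batchSize * P.real (confidenceFails I.batchSize θ γ T φ X τ t)) := by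
  set ρ := confRadius d I.batchSize T γ (1 / T) with hρ
  have hρ0 : 0 ≤ ρ := by rw [hρ]; unfold confRadius; positivity
  have hμ := hrun.mean_mem_unitCube hθ ht
  have hμM := hrun.mean_mem_meanVectors hθ ht
  set o : Ω → ℝ := fun ω => I.opt (meanVec θ (φ t ω)) with ho
  set r : Ω → ℝ := fun ω => I.r (S t ω) (meanVec θ (φ t ω)) with hr
  set u : Ω → Fin m → ℝ := fun ω => ucb γ (confRadius d I.batchSize T γ (1 / T))
      (fun s => φ s ω) (fun s => X s ω) (fun s => τ s ω) t with hu
  set N : Set Ω := {ω | α * I.opt (u ω) ≤ I.r (S t ω) (u ω)} with hN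
  obtain ⟨hom, hoi⟩ := hrun.integrable_opt_run hB hB0 hmono hI hθ ht
  have hri := hrun.integrable_r_run hmono hI hθ ht
  have ho0 : ∀ ω, 0 ≤ o ω := fun ω => C2MABT.opt_nonneg (hμ ω)
  have hr0 : ∀ ω, 0 ≤ r ω := fun ω => C2MABT.r_nonneg (hμ ω) _
  have huc : ∀ ω, u ω ∈ unitCube m := fun ω => ucb_mem_unitCube _ _ _ _ _ _
  have hum : Measurable u := measurable_ucb γ _ (fun s _ => hrun.measurable_φ s)
    (fun s _ => hrun.measurable_τ s)
    (fun s _ => measurable_observed (hrun.measurable_X s) (hrun.measurable_τ s))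
  have hNm : MeasurableSet N := by
    have e : N = {ω | α * I.opt (cubeProj m (u ω)) ≤ I.r (S t ω) (u ω)} := by
      ext ω
      simp only [hN, Set.mem_ofPred_eq, cubeProj_of_mem (huc ω)]
    rw [e]
    exact measurableSet_le (((hB.measurable_opt_cubeProj hB0 hI).comp hum).const_mul α)
      (I.measurable_r_comp hum (hrun.measurable_S t))
  -- Success of the oracle has conditional probability at least `β` given the history, and `o` is
  -- nonnegative and determined by the history.
  have horacle : β * ∫ ω, o ω ∂P ≤ ∫ ω in N, o ω ∂P := by
    have hfin : ∫⁻ ω, ENNReal.ofReal (o ω) ∂P ≠ ⊤ := hoi.lintegral_lt_top.ne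
    have h := hrun.le_setLIntegral_oracle hO hB hB0 hI ht hom.ennreal_ofReal hfin hu
    rw [← ofReal_integral_eq_lintegral_ofReal hoi (Filter.Eventually.of_forall ho0),
      ← ofReal_integral_eq_lintegral_ofReal hoi.restrict (Filter.Eventually.of_forall ho0),
      ← ENNReal.ofReal_mul hβ.1] at h
    exact (ENNReal.ofReal_le_ofReal_iff (integral_nonneg ho0)).mp h
  set E := confidenceFails I.batchSize θ γ T φ X τ t with hE
  have hEm : MeasurableSet E := hrun.measurableSet_confidenceFails t
  have hwm : ∀ i, Measurable (clippedWidth γ ρ φ τ t i) := fun i =>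
    (measurable_history_clippedWidth (S := S) (X := X) ρ t i).mono (hrun.history_le t) le_rfl
  have hp := fun ω i => C2MABT.trigProb_nonneg (I := I) (hμ ω) (S t ω) i
  have hsumi : Integrable (fun ω => ∑ i, I.trigProb (meanVec θ (φ t ω)) (S t ω) i *
      clippedWidth γ ρ φ τ t i ω) P :=
    integrable_of_measurable_of_mem_Icc (Finset.measurable_sum _ fun i _ =>
      (hrun.measurable_trigProb_run t i).mul (hwm i))
      (fun ω => Finset.sum_nonneg fun i _ => mul_nonneg (hp ω i) (clippedWidth_nonneg hρ0 t i ω))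
      (fun ω => C2MABT.sum_trigProb_mul_le (hμM ω) _ fun i => clippedWidth_le_one ρ t i ω)
  have hEi : Integrable (E.indicator fun _ => 2 * (I.batchSize : ℝ)) P :=
    (integrable_const _).indicator hEm
  have hrhs : ∀ ω, 0 ≤ B * (∑ i, I.trigProb (meanVec θ (φ t ω)) (S t ω) i *
      clippedWidth γ ρ φ τ t i ω + E.indicator (fun _ => 2 * (I.batchSize : ℝ)) ω) := fun ω =>
    mul_nonneg hB0 (add_nonneg (Finset.sum_nonneg fun i _ =>
      mul_nonneg (hp ω i) (clippedWidth_nonneg hρ0 t i ω))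
      (Set.indicator_nonneg (fun _ _ => by positivity) ω))
  calc ∫ ω, (α * β * o ω - r ω) ∂P = α * (β * ∫ ω, o ω ∂P) - ∫ ω, r ω ∂P := by
        rw [integral_sub (hoi.const_mul _) hri, integral_const_mul, mul_assoc]
    -- Rewards outside the success event are nonnegative and are dropped.
    _ ≤ α * ∫ ω in N, o ω ∂P - ∫ ω in N, r ω ∂P :=
        sub_le_sub (mul_le_mul_of_nonneg_left horacle hα.1)
          (setIntegral_le_integral hri (Filter.Eventually.of_forall hr0))
    _ = ∫ ω, N.indicator (fun ω => α * o ω - r ω) ω ∂P := by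
        rw [integral_indicator hNm, integral_sub (hoi.const_mul α).restrict hri.restrict,
          integral_const_mul]
    _ ≤ ∫ ω, B * (∑ i, I.trigProb (meanVec θ (φ t ω)) (S t ω) i * clippedWidth γ ρ φ τ t i ω +
          E.indicator (fun _ => 2 * (I.batchSize : ℝ)) ω) ∂P := by
        refine integral_mono (((hoi.const_mul α).sub hri).indicator hNm)
          ((hsumi.add hEi).const_mul B) fun ω => ?_
        by_cases hω : ω ∈ N
        · rw [Set.indicator_of_mem hω]
          exact hrun.gap_le_of_oracle_succeeds hα hB hB0 hmono hI hθ hθ1 hγ ht rfl hω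
        · rw [Set.indicator_of_notMem hω]
          exact hrhs ω
    _ = _ := by
        rw [integral_const_mul, integral_add hsumi hEi, integral_indicator hEm, setIntegral_const,
          hrun.integral_sum_trigProb_mul hθ ht (fun i => measurable_history_clippedWidth ρ t i)
            fun i ω => clippedWidth_nonneg hρ0 t i ω, smul_eq_mul, mul_comm (P.real E)]

theorem integrable_cumulativeGap (hrun : IsC2UCBTRun P I θ O γ T φ S X τ) [Nonempty 𝒮] {B : ℝ}
    (hB : I.TPMSmooth B) (hB0 : 0 ≤ B) (hmono : I.Monotonicity) (hI : I.FiniteOpt)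
    (hθ : θ ∈ I.Θ) (α β : ℝ) : Integrable (cumulativeGap I θ α β T φ S) P :=
  integrable_finsetSum _ fun _ ht =>
    have ht := Finset.mem_range.mp ht
    ((hrun.integrable_opt_run hB hB0 hmono hI hθ ht).2.const_mul (α * β)).sub
      (hrun.integrable_r_run hmono hI hθ ht)

/-- The regret bound in terms of an almost sure bound `W` on the sum of the clipped widths of the
triggered arms and of a bound `ε` on the failure probability of the confidence ellipsoids. -/
theorem approxRegret_le_of_width [IsMarkovKernel O] {α β B W ε : ℝ} (hα : α ∈ Set.Icc (0 : ℝ) 1)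
    (hβ : β ∈ Set.Icc (0 : ℝ) 1)
    (hrun : IsC2UCBTRun P I θ O γ T φ S X τ) (hO : I.IsApproxOracle α β O) [Nonempty 𝒮]
    (hB : I.TPMSmooth B) (hB0 : 0 ≤ B) (hmono : I.Monotonicity) (hI : I.FiniteOpt)
    (hθ : θ ∈ I.Θ) (hθ1 : ‖θ‖ ≤ 1) (hγ : 0 < γ)
    (hW : ∀ᵐ ω ∂P, ∑ t ∈ Finset.range T, ∑ i ∈ τ t ω,
      clippedWidth γ (confRadius d I.batchSize T γ (1 / T)) φ τ t i ω ≤ W)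
    (hε : ∀ t < T, P.real (confidenceFails I.batchSize θ γ T φ X τ t) ≤ ε) :
    approxRegret P I θ α β T φ S ≤ B * (W + 2 * I.batchSize * (T * ε)) := by
  set ρ := confRadius d I.batchSize T γ (1 / T) with hρ
  have hρ0 : 0 ≤ ρ := by rw [hρ]; unfold confRadius; positivity
  have hint : ∀ t, Integrable (fun ω => ∑ i ∈ τ t ω, clippedWidth γ ρ φ τ t i ω) P := fun t =>
    integrable_of_measurable_of_mem_Icc (c := m) (hrun.measurable_sum_triggered (fun i =>
      (measurable_history_clippedWidth (S := S) (X := X) ρ t i).mono (hrun.history_le t) le_rfl) t)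
      (fun ω => Finset.sum_nonneg fun i _ => clippedWidth_nonneg hρ0 t i ω)
      (fun ω => (Finset.sum_le_sum fun i _ => clippedWidth_le_one ρ t i ω).trans (by
        simpa using (Finset.card_le_univ (τ t ω))))
  calc approxRegret P I θ α β T φ S
      = ∑ t ∈ Finset.range T, ∫ ω, (α * β * I.opt (meanVec θ (φ t ω)) -
          I.r (S t ω) (meanVec θ (φ t ω))) ∂P := by
        unfold approxRegret cumulativeGap
        refine integral_finsetSum _ fun t ht => ?_
        have ht := Finset.mem_range.mp ht
        exact ((hrun.integrable_opt_run hB hB0 hmono hI hθ ht).2.const_mul (α * β)).sub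
          (hrun.integrable_r_run hmono hI hθ ht)
    _ ≤ ∑ t ∈ Finset.range T, B * (∫ ω, ∑ i ∈ τ t ω, clippedWidth γ ρ φ τ t i ω ∂P +
          2 * I.batchSize * ε) := by
        refine Finset.sum_le_sum fun t ht => ?_
        have ht := Finset.mem_range.mp ht
        refine (hrun.integral_gap_le hα hβ hO hB hB0 hmono hI hθ hθ1 hγ ht).trans ?_
        have := hε t ht
        gcongr
    _ = B * (∫ ω, ∑ t ∈ Finset.range T, ∑ i ∈ τ t ω, clippedWidth γ ρ φ τ t i ω ∂P +
          2 * I.batchSize * (T * ε)) := by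
        rw [integral_finsetSum _ fun t _ => hint t, ← Finset.mul_sum, Finset.sum_add_distrib,
          Finset.sum_const, Finset.card_range, nsmul_eq_mul]
        ring
    _ ≤ B * (W + 2 * I.batchSize * (T * ε)) := by
        refine mul_le_mul_of_nonneg_left (add_le_add_left ?_ _) hB0
        refine (integral_mono_ae (integrable_finsetSum _ fun t _ => hint t)
          (integrable_const W) hW).trans ?_
        simp

end IsC2UCBTRun

/-! ### Numerical estimates behind the constants. -/

section RegretArithmetic

theorem Real.sqrt_le_add_sqrt_of_le {x a b p q : ℝ} (ha : 0 ≤ a) (hb : 0 ≤ b) (hp : 0 ≤ p)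
    (hq : 0 ≤ q) (h : x ≤ p ^ 2 * a + q ^ 2 * b) : √x ≤ p * √a + q * √b := by
  refine Real.sqrt_le_iff.mpr ⟨by positivity, h.trans ?_⟩
  have h1 := Real.sq_sqrt ha
  have h2 := Real.sq_sqrt hb
  have : 0 ≤ p * √a * (q * √b) := by positivity
  nlinarith

theorem log_det_bound_le {d K T : ℕ} {γ : ℝ} (hγ : 0 < γ) (hd : 0 < d) (hKT : 2 * γ ≤ K * T) :
    Real.log ((γ + K * T / d) ^ d / γ ^ d) ≤ 2 * (d * Real.log (K * T / γ)) := by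
  have hd1 : (1 : ℝ) ≤ d := by exact_mod_cast hd
  have hx : 2 ≤ (K * T : ℝ) / γ := by rwa [le_div_iff₀ hγ]
  have hKT0 : (0 : ℝ) ≤ K * T := by positivity
  -- With `x = K T / γ ≥ 2` the left side is at most `1 + x ≤ x²`, whence the factor `2`.
  have h1 : (γ + K * T / d) / γ ≤ (K * T / γ) ^ 2 := by
    have h2 : (γ + K * T / d) / γ ≤ 1 + K * T / γ := by
      rw [add_div, div_self hγ.ne']
      gcongr
      exact div_le_self hKT0 hd1
    nlinarith
  rw [← div_pow, Real.log_pow]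
  have h3 := Real.log_le_log (by positivity) h1
  rw [Real.log_pow] at h3
  push_cast at h3
  calc (d : ℝ) * Real.log ((γ + K * T / d) / γ) ≤ d * (2 * Real.log (K * T / γ)) := by gcongr
    _ = _ := by ring

theorem confRadius_le {d K T : ℕ} {γ : ℝ} (hγ : 0 < γ) (hd : 0 < d) (hK : 0 < K) (hT : 0 < T)
    (hKT : 2 * γ ≤ K * T) :
    confRadius d K T γ (1 / T) ≤ 3 * (√(d * Real.log (K * T / γ)) + √γ) := by
  have hT0 : (0 : ℝ) < T := by exact_mod_cast hT
  have hK1 : (1 : ℝ) ≤ K := by exact_mod_cast hK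
  have hd1 : (1 : ℝ) ≤ d := by exact_mod_cast hd
  have hx : 2 ≤ (K * T : ℝ) / γ := by rwa [le_div_iff₀ hγ]
  set L := Real.log (K * T / γ) with hL
  have hL0 : 0 ≤ L := Real.log_nonneg (by linarith)
  -- The term `2 log T` from `δ = 1/T` is controlled through `T ≤ K T = (K T / γ) γ` and `log γ ≤
  -- γ`.
  have hlogT : Real.log T ≤ L + γ := by
    have h1 : Real.log T ≤ Real.log (K * T / γ * γ) := by
      rw [div_mul_cancel₀ _ hγ.ne']
      exact Real.log_le_log hT0 (le_mul_of_one_le_left hT0.le hK1)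
    rw [Real.log_mul (by positivity) hγ.ne'] at h1
    linarith [Real.log_le_sub_one_of_pos hγ]
  have e : (γ + K * T / d) ^ d / (γ ^ d * (1 / (T : ℝ)) ^ 2) =
      (γ + K * T / d) ^ d / γ ^ d * (T : ℝ) ^ 2 := by
    field_simp
  have hlog : Real.log ((γ + K * T / d) ^ d / (γ ^ d * (1 / (T : ℝ)) ^ 2)) ≤
      2 ^ 2 * (d * L) + 2 ^ 2 * γ := by
    rw [e, Real.log_mul (by positivity) (by positivity), Real.log_pow]
    have := log_det_bound_le hγ hd hKT
    push_cast
    nlinarith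
  have h := Real.sqrt_le_add_sqrt_of_le (by positivity) hγ.le two_pos.le two_pos.le hlog
  unfold confRadius
  have := Real.sqrt_nonneg (d * L)
  linarith

/-- The batch size is dominated by the regret bound. -/
theorem batch_le {K T dL γ : ℝ} (hK : 0 ≤ K) (hT : 1 ≤ T) (hγ : 0 < γ) (hdL : 1 / 2 ≤ dL)
    (h : K ≤ max γ T) : K ≤ 2 * ((√dL + √γ) * √(K * T * dL)) := by
  have hdL0 : 0 ≤ dL := by linarith
  have hs : 1 / 2 ≤ √dL := Real.le_sqrt_of_sq_le (by nlinarith)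
  have hγ0 := Real.sqrt_nonneg γ
  rw [Real.sqrt_mul (by positivity)]
  have hKT := Real.sqrt_nonneg (K * T)
  -- If `K ≤ γ`, then `K ≤ √γ √(KT)`, absorbed by the `√γ` term; if `K ≤ T`, then `K ≤ √(KT)`,
  -- absorbed by the `√dL` term. The lower bound `1/2` on `dL` costs the factor `2`.
  rcases le_max_iff.mp h with h | h
  · have h1 : K ≤ √γ * √(K * T) := by
      rw [← Real.sqrt_mul hγ.le]
      refine Real.le_sqrt_of_sq_le ?_
      nlinarith [mul_le_mul_of_nonneg_left hT hK, mul_nonneg hK hγ.le,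
        mul_le_mul_of_nonneg_left h hK, mul_nonneg (mul_nonneg hK hγ.le) (sub_nonneg.mpr hT)]
    have h2 : 0 ≤ √γ * √(K * T) := by positivity
    have h3 : 0 ≤ √dL * (√(K * T) * √dL) := by positivity
    nlinarith
  · have h1 : K ≤ √(K * T) := Real.le_sqrt_of_sq_le (by nlinarith)
    have h2 : √dL * (√(K * T) * √dL) = √(K * T) * dL := by
      rw [mul_left_comm, Real.mul_self_sqrt hdL0]
    have h3 : 0 ≤ √γ * (√(K * T) * √dL) := by positivity
    nlinarith

/-- The contribution of the rounds with a large batch width. -/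
theorem ite_batch_mul_le {K T dL γ : ℝ} (hK : 0 ≤ K) (hT : 0 ≤ T) (hdL : 0 ≤ dL)
    (h : K ≤ max γ T) :
    (if K ≤ γ then 0 else K) * (2 * dL / Real.log 2) ≤ 4 * ((√dL + √γ) * √(K * T * dL)) := by
  have hγ0 := Real.sqrt_nonneg γ
  split_ifs with hc
  · rw [zero_mul]; positivity
  have hKT : K ≤ T := (le_max_iff.mp h).resolve_left hc
  have h1 : K ≤ √(K * T) := Real.le_sqrt_of_sq_le (by nlinarith)
  rw [Real.sqrt_mul (by positivity)]
  have h2 : √dL * (√(K * T) * √dL) = √(K * T) * dL := by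
    rw [mul_left_comm, Real.mul_self_sqrt hdL]
  have h3 : 0 ≤ √γ * (√(K * T) * √dL) := by positivity
  have hl := Real.log_two_gt_d9
  have h4 : 2 * dL / Real.log 2 ≤ 4 * dL := by
    rw [div_le_iff₀ (by linarith)]
    nlinarith
  have h5 := mul_le_mul h1 h4 (by positivity) (by positivity)
  nlinarith

/-- Only the cross term with `√γ` loses a constant: `√(d L) ≤ 2 d L` because `d L ≥ 1/2`. -/
theorem second_bound_le {KT L γ : ℝ} {d : ℕ} (hd : 0 < d) (hKT : 0 ≤ KT)
    (hL : 1 / 2 ≤ L) : (√(d * L) + √γ) * √(KT * d * L) ≤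
      2 * ((1 + √γ) * (d * √KT * L)) := by
  have hd1 : (1 : ℝ) ≤ d := by exact_mod_cast hd
  have hdL : 1 / 2 ≤ d * L := by nlinarith
  have hs : √(d * L) ≤ 2 * (d * L) := Real.sqrt_le_iff.mpr ⟨by positivity, by nlinarith⟩
  rw [mul_assoc KT, Real.sqrt_mul hKT]
  have h2 : √(d * L) * (√KT * √(d * L)) = √KT * (d * L) := by
    rw [mul_left_comm, Real.mul_self_sqrt (by linarith)]
  have h3 := mul_le_mul_of_nonneg_left hs (by positivity : 0 ≤ √γ * √KT)
  have h4 : 0 ≤ √KT * (d * L) := mul_nonneg (Real.sqrt_nonneg _) (by linarith)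
  nlinarith

end RegretArithmetic

/-! ### Assembly of the regret bound. -/

theorem C2MABT.nonempty_action_of_batchSize_pos {m d : ℕ} {𝒮 : Type*} [MeasurableSpace 𝒮]
    {I : C2MABT m d 𝒮} (h : 0 < I.batchSize) : Nonempty 𝒮 := by
  by_contra h'
  have := not_nonempty_iff.mp h'
  simp [C2MABT.batchSize] at h

namespace IsC2UCBTRun

variable {m d : ℕ} {𝒮 : Type*} [MeasurableSpace 𝒮] {Ω : Type*} [MeasurableSpace Ω]
  {P : Measure Ω} [IsProbabilityMeasure P] {I : C2MABT m d 𝒮} {θ : EuclideanSpace ℝ (Fin d)}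
  {O : Kernel (Fin m → ℝ) 𝒮} {γ : ℝ} {T : ℕ} {φ : ℕ → Ω → FeatureMap m d} {S : ℕ → Ω → 𝒮}
  {X : ℕ → Ω → Fin m → Bool} {τ : ℕ → Ω → Finset (Fin m)}

/-- In dimension zero all means vanish and there is no regret. -/
theorem approxRegret_nonpos_of_dim_eq_zero [IsMarkovKernel O] {α β B : ℝ}
    (hα : α ∈ Set.Icc (0 : ℝ) 1) (hβ : β ∈ Set.Icc (0 : ℝ) 1)
    (hrun : IsC2UCBTRun P I θ O γ T φ S X τ) (hO : I.IsApproxOracle α β O) [Nonempty 𝒮]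
    (hB : I.TPMSmooth B) (hB0 : 0 ≤ B) (hmono : I.Monotonicity) (hI : I.FiniteOpt)
    (hθ : θ ∈ I.Θ) (hθ1 : ‖θ‖ ≤ 1) (hγ : 0 < γ) (hd : d = 0) :
    approxRegret P I θ α β T φ S ≤ 0 := by
  subst hd
  have h := hrun.approxRegret_le_of_width (W := 0) (ε := 0) hα hβ hO hB hB0 hmono hI hθ hθ1 hγ
    (Filter.Eventually.of_forall fun ω => le_of_eq (Finset.sum_eq_zero fun t _ =>
      Finset.sum_eq_zero fun i _ => by simp [clippedWidth, armWidth, dotProduct]))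
    fun t _ => by
      have : confidenceFails I.batchSize θ γ T φ X τ t = ∅ := by
        refine Set.eq_empty_of_forall_notMem fun ω hω => ?_
        have hω : √_ < √_ := hω
        simp only [dotProduct, Finset.univ_eq_empty, Finset.sum_empty, Real.sqrt_zero] at hω
        exact absurd hω (not_lt.mpr (Real.sqrt_nonneg _))
      simp [this]
  simpa using h

/-- The constant is `20 = 4 + 12 + 4`: rounds with large batch width, the Cauchy–Schwarz term `4 ρ
√(K T d L)` with `confRadius_le`, and the failure cost `2 K` with `batch_le`. -/
theorem approxRegret_le [IsMarkovKernel O] {α β B : ℝ}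
    (hα : α ∈ Set.Icc (0 : ℝ) 1) (hβ : β ∈ Set.Icc (0 : ℝ) 1)
    (hrun : IsC2UCBTRun P I θ O γ T φ S X τ) (hO : I.IsApproxOracle α β O) [Nonempty 𝒮]
    (hB : I.TPMSmooth B) (hB0 : 0 ≤ B) (hmono : I.Monotonicity) (hI : I.FiniteOpt)
    (htrig : I.TriggeringByObserved) (hθ : θ ∈ I.Θ) (hθ1 : ‖θ‖ ≤ 1) (hγ : 0 < γ) (hd : 0 < d)
    (hK : 0 < I.batchSize) (hT : 0 < T) (hKm : (I.batchSize : ℝ) ≤ max γ T)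
    (hKT : 2 * γ ≤ I.batchSize * T) (hL : 1 / 2 ≤ Real.log (I.batchSize * T / γ)) :
    approxRegret P I θ α β T φ S ≤
      20 * (B * ((√(d * Real.log (I.batchSize * T / γ)) + √γ) *
        √(I.batchSize * T * d * Real.log (I.batchSize * T / γ)))) := by
  set K := I.batchSize with hKdef
  set L := Real.log (K * T / γ) with hLdef
  set ρ := confRadius d K T γ (1 / T) with hρ
  have hρ0 : 0 ≤ ρ := by rw [hρ]; unfold confRadius; positivity
  have hd1 : (1 : ℝ) ≤ d := by exact_mod_cast hd
  have hT1 : (1 : ℝ) ≤ T := by exact_mod_cast hT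
  have hdL : 1 / 2 ≤ d * L := by nlinarith
  have hcard : ∀ᵐ ω ∂P, ∀ t < T, (τ t ω).card ≤ K :=
    ae_all_iff.mpr fun t => by
      by_cases ht : t < T
      · filter_upwards [hrun.ae_card_triggered_le hθ ht] with ω hω _ using hω
      · exact Filter.Eventually.of_forall fun ω h => absurd h ht
  have h := hrun.approxRegret_le_of_width (ε := 1 / T) hα hβ hO hB hB0 hmono hI hθ hθ1 hγ
    (by
      filter_upwards [hcard] with ω hω
      exact sum_sum_min_one_armWidth_le hγ hρ0 (φ := fun s => φ s ω) (τ := fun s => τ s ω)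
        (fun t ht i => I.norm_feature_le _ (hrun.φ_mem t ht ω) i) hω
        (log_det_bound_le hγ hd hKT))
    fun t ht => ENNReal.toReal_le_of_le_ofReal (by positivity)
      (hrun.measure_confidence_fails_le htrig hθ hγ hT ht)
  refine h.trans ?_
  rw [mul_left_comm 20 B]
  refine mul_le_mul_of_nonneg_left ?_ hB0
  have h1 := ite_batch_mul_le (K := K) (T := T) (γ := γ) K.cast_nonneg T.cast_nonneg
    (show 0 ≤ d * L by linarith) hKm
  have h2 := batch_le (K := K) (γ := γ) K.cast_nonneg hT1 hγ hdL hKm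
  have h3 : 2 * ρ * √(2 * (K * T) * (2 * (d * L))) = 4 * (ρ * √(K * T * (d * L))) := by
    rw [show 2 * ((K : ℝ) * T) * (2 * (d * L)) = 2 ^ 2 * (K * T * (d * L)) by ring,
      Real.sqrt_mul (by positivity), Real.sqrt_sq two_pos.le]
    ring
  have h4 := mul_le_mul_of_nonneg_right (confRadius_le hγ hd hK hT hKT)
    (Real.sqrt_nonneg (K * T * (d * L)))
  have h5 : (T : ℝ) * (1 / T) = 1 := mul_one_div_cancel (by positivity)
  rw [mul_assoc (K * T : ℝ) d L, h5, ← hKdef, ← hLdef, h3]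
  rw [← hLdef, ← hρ] at h4
  linarith

end IsC2UCBTRun

end

theorem mainTheorem1 :
    ∃ C : ℝ, 0 < C ∧
      ∀ (m d : ℕ) (𝒮 : Type*) [MeasurableSpace 𝒮] (I : C2MABT m d 𝒮) (B₁ : ℝ),
        I.FiniteOpt → I.TriggeringByObserved → I.Monotonicity → I.TPMSmooth B₁ →
      ∀ (α β : ℝ), α ∈ Set.Icc (0 : ℝ) 1 → β ∈ Set.Icc (0 : ℝ) 1 →
      ∀ (O : Kernel (Fin m → ℝ) 𝒮) [IsMarkovKernel O], I.IsApproxOracle α β O →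
      ∀ (θ : EuclideanSpace ℝ (Fin d)), θ ∈ I.Θ → ‖θ‖ ≤ 1 →
      ∀ (γ : ℝ) (T : ℕ), 0 < γ → (I.batchSize : ℝ) ≤ max γ T → 2 * γ ≤ I.batchSize * T →
      ∀ (Ω : Type*) [MeasurableSpace Ω] (P : Measure Ω) [IsProbabilityMeasure P]
        (φ : ℕ → Ω → FeatureMap m d) (S : ℕ → Ω → 𝒮) (X : ℕ → Ω → Fin m → Bool)
        (τ : ℕ → Ω → Finset (Fin m)),
        IsC2UCBTRun P I θ O γ T φ S X τ →
        Integrable (cumulativeGap I θ α β T φ S) P ∧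
        approxRegret P I θ α β T φ S ≤
          C * (B₁ * (√(d * Real.log (I.batchSize * T / γ)) + √γ) *
            √(I.batchSize * T * d * Real.log (I.batchSize * T / γ))) ∧
        approxRegret P I θ α β T φ S ≤
          C * (1 + √γ) * (B₁ * d * √(I.batchSize * T) *
            Real.log (I.batchSize * T / γ)) := by
  -- The factor `20` of `approxRegret_le`, doubled by `second_bound_le` for the second form of the
  -- bound.
  refine ⟨40, by norm_num, ?_⟩
  intro m d 𝒮 _ I B₁ hI htrig hmono hB α β hα hβ O _ hO θ hθ hθ1 γ T hγ hKm hKT Ω _ P _ φ S X τ hrun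
  have hKT0 : (0 : ℝ) < I.batchSize * T := by linarith
  have hK : 0 < I.batchSize := Nat.pos_of_ne_zero fun h => by simp [h] at hKT0
  have hT : 0 < T := Nat.pos_of_ne_zero fun h => by simp [h] at hKT0
  have hB0 := hB.nonneg hK
  have := C2MABT.nonempty_action_of_batchSize_pos hK
  refine ⟨hrun.integrable_cumulativeGap hB hB0 hmono hI hθ α β, ?_⟩
  have hx : 2 ≤ (I.batchSize * T : ℝ) / γ := by rwa [le_div_iff₀ hγ]
  have hL : 1 / 2 ≤ Real.log (I.batchSize * T / γ) := by
    have := Real.log_le_log two_pos hx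
    linarith [Real.log_two_gt_d9]
  -- For `d = 0` both right-hand sides vanish, so the regret must be shown nonpositive separately.
  rcases d.eq_zero_or_pos with hd | hd
  · have h := hrun.approxRegret_nonpos_of_dim_eq_zero hα hβ hO hB hB0 hmono hI hθ hθ1 hγ hd
    constructor <;> simpa [hd] using h
  have h := hrun.approxRegret_le hα hβ hO hB hB0 hmono hI htrig hθ hθ1 hγ hd hK hT hKm hKT hL
  constructor
  · refine h.trans ?_
    rw [mul_assoc B₁]
    refine mul_le_mul_of_nonneg_right (by norm_num) (by positivity)
  · refine h.trans ?_
    have h2 := mul_le_mul_of_nonneg_left (second_bound_le (γ := γ) hd hKT0.le hL) hB0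
    calc _ ≤ 20 * (B₁ * (2 * ((1 + √γ) * (d * √(I.batchSize * T) *
          Real.log (I.batchSize * T / γ))))) := mul_le_mul_of_nonneg_left h2 (by norm_num)
      _ = _ := by ring
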